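/- Let $d\ge 1$, let $I^d=(0,1)^d$, and let $\omega_d$ be the Lebesgue measure of the unit ball of $\mathbb{R}^d$. For $\alpha>0$ and $n\in\mathbb{N}$ put $r=\alpha n^{-1/d}$ and let $\mathcal{A}(\alpha,n)$ be the family of all sets $\Sigma=\overline{I^d}\cap\bigcup_{i=1}^n\overline{B(x_i,r)}$ with $x_1,\dots,x_n$ in the $r$-neighbourhood of $I^d$. For such $\Sigma$ let $u_\Sigma\in H^1_0(I^d\setminus\Sigma)$ be the weak solution of $-\Delta u=1$ in $I^d\setminus\Sigma$, $u=0$ in $\Sigma\cup\partial I^d$, that is, $\int_{I^d}\nabla u_\Sigma\cdot\nabla\varphi=\int_{I^d}\varphi$ for all $\varphi\in H^1_0(I^d\setminus\Sigma)$, and let $F(\Sigma)=\int_{I^d}u_\Sigma$ be its compliance. Define $$\theta(\alpha)=\inf\Big\{\liminf_{n\to\infty} n^{2/d}F(\Sigma_n)\ :\ \Sigma_n\in\mathcal{A}(\alpha,n)\text{ for all }n\Big\}\quad(\alpha>0),\qquad t_1=\inf\{t>0:\theta(t)=0\}.$$ Then $\theta$ is finite on $(0,\infty)$, $t_1>0$,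 and $\theta$ is differentiable at almost every $\alpha\in(0,t_1)$. For every $\alpha\in(0,t_1)$ at which $\theta$ is differentiable, $$-\theta'(\alpha)\ \ge\ \frac{\alpha^{1-d}}{d\,\omega_d}-\frac{2\alpha}{d}.$$ Moreover, there is a constant $C=C(d)$ such that for all $\alpha\in(0,t_1)$ $$\theta(\alpha)\ \ge\ \frac{\alpha^{2-d}}{d(d-2)\,\omega_d}-C\quad\text{if } d\ge 3,\qquad \theta(\alpha)\ \ge\ \frac{\log(\alpha^{-1})}{2\pi}-C\quad\text{if } d=2.$$ -/

import Mathlib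

open MeasureTheory Set Filter Topology
open scoped ENNReal ContDiff

namespace OptimalCompliance

/-- The Euclidean space `ℝ^d`. -/
abbrev E (d : ℕ) := EuclideanSpace ℝ (Fin d)

/-- Test functions on `U`: the space `C_c^∞(U)`, each function being extended by zero to `ℝ^d`. -/
def IsTestFunction {d : ℕ} (U : Set (E d)) (φ : E d → ℝ) : Prop :=
  ContDiff ℝ ∞ φ ∧ HasCompactSupport φ ∧ tsupport φ ⊆ U

/-- `u ∈ H¹₀(U)` with weak gradient `g`, both extended by zero to `ℝ^d`: the pair `(u, g)` is a limit
in `L²` of pairs `(φ, ∇φ)` with `φ ∈ C_c^∞(U)`, so `u` is in the closure of `C_c^∞(U)` for the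
`H¹`-norm. -/
def MemH10With {d : ℕ} (U : Set (E d)) (u : E d → ℝ) (g : E d → E d) : Prop :=
  MemLp u 2 volume ∧ MemLp g 2 volume ∧
    ∃ φ : ℕ → E d → ℝ, (∀ k, IsTestFunction U (φ k)) ∧
      Tendsto (fun k => eLpNorm (fun x => φ k x - u x) 2 volume) atTop (𝓝 0) ∧
      Tendsto (fun k => eLpNorm (fun x => gradient (φ k) x - g x) 2 volume) atTop (𝓝 0)

/-- `u` is a weak solution of `-Δu = f` in `Ω \ S`, `u = 0` in `S ∪ ∂Ω`: that is, `u ∈ H¹₀(Ω \ S)` and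
`∫_Ω ∇u · ∇φ = ∫_Ω f φ` for all `φ ∈ H¹₀(Ω \ S)`. -/
def IsWeakSolution {d : ℕ} (f : E d → ℝ) (S Ω : Set (E d)) (u : E d → ℝ) : Prop :=
  ∃ g : E d → E d, MemH10With (Ω \ S) u g ∧
    ∀ (φ : E d → ℝ) (h : E d → E d), MemH10With (Ω \ S) φ h →
      ∫ x in Ω, inner ℝ (g x) (h x) = ∫ x in Ω, f x * φ x

open Classical in
/-- The weak solution `u_{f,S,Ω}` (unique up to null sets when `Ω` is bounded). -/
noncomputable def solution {d : ℕ} (f : E d → ℝ) (S Ω : Set (E d)) : E d → ℝ :=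
  if h : ∃ u, IsWeakSolution f S Ω u then h.choose else 0

/-- The compliance `F(S, f, Ω) = ∫_Ω f u_{f,S,Ω}`. -/
noncomputable def compliance {d : ℕ} (S : Set (E d)) (f : E d → ℝ) (Ω : Set (E d)) : ℝ :=
  ∫ x in Ω, f x * solution f S Ω x

/-- The class `A(α, n)(Ω)` of the traces on the closure of `Ω` of unions of `n` closed balls of radius
`r = α n^{-1/d}` with centres in the `r`-neighbourhood of `Ω`. -/
def admissible {d : ℕ} (α : ℝ) (n : ℕ) (Ω : Set (E d)) : Set (Set (E d)) :=
  {S | ∃ x : Fin n → E d,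
    (∀ i, x i ∈ Metric.thickening (α * (n : ℝ) ^ (-(1 / (d : ℝ)))) Ω) ∧
    S = closure Ω ∩ ⋃ i, Metric.closedBall (x i) (α * (n : ℝ) ^ (-(1 / (d : ℝ))))}

/-- The open unit cube `(0,1)^d`. -/
def unitCube (d : ℕ) : Set (E d) := {x | ∀ i, x i ∈ Ioo (0 : ℝ) 1}

/-- The infimum of `liminf_n n^{2/d} F(Σ_n, 1, I^d)` over all sequences `Σ_n ∈ A(α, n)(I^d)`, as an
element of `[0, ∞]` (the lower limit is infinite for some sequences). -/
noncomputable def thetaExt (d : ℕ) (α : ℝ) : ℝ≥0∞ :=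
  ⨅ (S : ℕ → Set (E d)) (_ : ∀ n, S n ∈ admissible α n (unitCube d)),
    liminf (fun n : ℕ =>
      ENNReal.ofReal ((n : ℝ) ^ (2 / (d : ℝ)) * compliance (S n) (fun _ => 1) (unitCube d))) atTop

/-- The function `θ` as a real-valued function. -/
noncomputable def theta (d : ℕ) (α : ℝ) : ℝ := (thetaExt d α).toReal

/-- The first vanishing point `t₁` of `θ` on the positive half-line. -/
noncomputable def t₁ (d : ℕ) : ℝ := sInf {t : ℝ | 0 < t ∧ thetaExt d t = 0}

/-- The Lebesgue measure `ω_d` of the unit ball of `ℝ^d`. -/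
noncomputable def unitBallVolume (d : ℕ) : ℝ := volume.real (Metric.ball (0 : E d) 1)

end OptimalCompliance

/-! The compliance of `S` is the supremum of `energy φ = 2 ∫ φ - ∫ |∇φ|²` over test functions of the
cube minus `S` (`isLUB_energy_compliance`), so each competitor gives a lower bound.

Fix the centres and compare radii `r < R`. To a competitor `φ` for radius `R` add `g χ`, where `g`
depends on the distance to the centres only: it vanishes near the `r`-balls, has slope at most `Q`,
and is constant, almost equal to `Q (R - r)`, outside the `R`-balls; `χ` cuts off near the boundary
of the cube. The gradient of `g` lives in the annuli, where `φ` vanishes, so the two Dirichlet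
energies add up with no cross term. The gain is about `2 Q (R - r) (1 - n ω R^d)` and the cost at
most about `Q² n ω (R^d - r^d)` (`cubeCompliance_ballTrace_ge`). With `r`, `R`, `Q` equal to `α`,
`β`, `q` times `n^(-1/d)`, the cost of `χ` disappears as `n → ∞`, and `theta_add_le` results: `θ(β)
+ 2 q (β - α) (1 - ω β^d) - q² ω (β^d - α^d) ≤ θ(α)` for all `q ≥ 0`.

Everything else about `θ` comes from this inequality. Taking `q = 0` gives monotonicity, hence
differentiability almost everywhere; the optimal `q` gives positivity for small radii, hence `t₁ >
0`; dividing by `β - α` and letting `β` decrease to `α` gives the bound on `θ'`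
(`neg_deriv_theta_ge`). Integrating that bound up to `t₁` gives the explicit lower bounds
(`theta_sub_ge`).

Upper bounds use grids. Balls dense enough to meet all segments of length of order `n^(-1/d)` in one
direction give finiteness, by a Poincaré inequality along these segments
(`exists_ballTrace_compliance_le`); balls covering the cube show that `θ` vanishes somewhere, so
that the infimum defining `t₁` is over a nonempty set. -/

namespace OptimalCompliance

variable {d : ℕ}

/-! ### Test functions -/

namespace IsTestFunction

variable {U V : Set (E d)} {φ ψ : E d → ℝ}

theorem mono (h : IsTestFunction U φ) (hUV : U ⊆ V) : IsTestFunction V φ :=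
  ⟨h.1, h.2.1, h.2.2.trans hUV⟩

theorem zero : IsTestFunction U (fun _ => (0 : ℝ)) := by
  refine ⟨contDiff_const, HasCompactSupport.zero, ?_⟩
  have : tsupport (fun _ : E d => (0 : ℝ)) = ∅ := tsupport_eq_empty_iff.2 rfl
  simp [this]

theorem add (hφ : IsTestFunction U φ) (hψ : IsTestFunction U ψ) :
    IsTestFunction U (fun x => φ x + ψ x) :=
  ⟨hφ.1.add hψ.1, hφ.2.1.add hψ.2.1, (tsupport_add φ ψ).trans (union_subset hφ.2.2 hψ.2.2)⟩

theorem const_mul (c : ℝ) (hφ : IsTestFunction U φ) : IsTestFunction U (fun x => c * φ x) :=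
  ⟨contDiff_const.mul hφ.1, hφ.2.1.mul_left,
    (closure_mono (Function.support_mul_subset_right (fun _ => c) φ)).trans hφ.2.2⟩

theorem differentiable (hφ : IsTestFunction U φ) : Differentiable ℝ φ :=
  hφ.1.differentiable (by simp)

theorem eq_zero (hφ : IsTestFunction U φ) {x : E d} (hx : x ∉ U) : φ x = 0 :=
  image_eq_zero_of_notMem_tsupport fun h => hx (hφ.2.2 h)

theorem gradient_eq_zero (hφ : IsTestFunction U φ) {x : E d} (hx : x ∉ U) :
    gradient φ x = 0 := by
  have h1 : φ =ᶠ[𝓝 x] fun _ => (0 : ℝ) := by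
    have := notMem_tsupport_iff_eventuallyEq.1 fun h => hx (hφ.2.2 h)
    exact this
  rw [h1.gradient_eq]
  simp [gradient]

theorem continuous_gradient (hφ : IsTestFunction U φ) : Continuous (gradient φ) := by
  unfold gradient
  exact (InnerProductSpace.toDual ℝ (E d)).symm.continuous.comp
    (hφ.1.continuous_fderiv (by simp))

theorem hasCompactSupport_gradient (hφ : IsTestFunction U φ) :
    HasCompactSupport (gradient φ) := by
  have := (hφ.2.1.fderiv (𝕜 := ℝ)).comp_left
    (g := fun f => (InnerProductSpace.toDual ℝ (E d)).symm f) (map_zero _)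
  exact this

theorem memLp (hφ : IsTestFunction U φ) : MemLp φ 2 volume :=
  hφ.1.continuous.memLp_of_hasCompactSupport hφ.2.1

theorem memLp_gradient (hφ : IsTestFunction U φ) : MemLp (gradient φ) 2 volume :=
  hφ.continuous_gradient.memLp_of_hasCompactSupport hφ.hasCompactSupport_gradient

theorem integrable (hφ : IsTestFunction U φ) : Integrable φ :=
  hφ.1.continuous.integrable_of_hasCompactSupport hφ.2.1

theorem integrable_sq (hφ : IsTestFunction U φ) : Integrable (fun x => φ x ^ 2) :=
  hφ.memLp.integrable_sq

theorem integrable_norm_gradient_sq (hφ : IsTestFunction U φ) :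
    Integrable (fun x => ‖gradient φ x‖ ^ 2) :=
  (memLp_two_iff_integrable_sq_norm hφ.memLp_gradient.1).1 hφ.memLp_gradient

theorem setIntegral_eq (hφ : IsTestFunction U φ) (hUV : U ⊆ V) : ∫ x in V, φ x = ∫ x, φ x :=
  setIntegral_eq_integral_of_forall_compl_eq_zero fun _ hx => hφ.eq_zero fun h => hx (hUV h)

end IsTestFunction

theorem gradient_add_apply {φ ψ : E d → ℝ} (hφ : Differentiable ℝ φ) (hψ : Differentiable ℝ ψ)
    (x : E d) : gradient (fun y => φ y + ψ y) x = gradient φ x + gradient ψ x := by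
  simp only [gradient]
  rw [fderiv_fun_add (hφ x) (hψ x), map_add]

theorem gradient_const_mul_apply {φ : E d → ℝ} (hφ : Differentiable ℝ φ) (c : ℝ)
    (x : E d) : gradient (fun y => c * φ y) x = c • gradient φ x := by
  simp only [gradient]
  rw [fderiv_const_mul (hφ x), map_smul]

theorem gradient_mul_apply {φ ψ : E d → ℝ} (hφ : Differentiable ℝ φ) (hψ : Differentiable ℝ ψ)
    (x : E d) : gradient (fun y => φ y * ψ y) x = φ x • gradient ψ x + ψ x • gradient φ x := by
  simp only [gradient]
  rw [fderiv_fun_mul (hφ x) (hψ x), map_add, map_smul, map_smul]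

theorem norm_gradient (φ : E d → ℝ) (x : E d) : ‖gradient φ x‖ = ‖fderiv ℝ φ x‖ := by
  simp [gradient]

/-- The functional `2 ∫ φ - ∫ |∇φ|²`, whose supremum is the compliance. -/
noncomputable def energy (φ : E d → ℝ) : ℝ := (2 * ∫ x, φ x) - ∫ x, ‖gradient φ x‖ ^ 2

/-! ### The space `H¹₀` as a Hilbert space -/

/-- The ambient Hilbert space of pairs (function, weak gradient). -/
abbrev PairSpace (d : ℕ) :=
  WithLp 2 (Lp ℝ 2 (volume : Measure (E d)) × Lp (E d) 2 (volume : Measure (E d)))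

/-- The pairs `(φ, ∇φ)` of test functions and their gradients. -/
noncomputable def testPairs (U : Set (E d)) : Submodule ℝ (PairSpace d) where
  carrier := {k | ∃ φ, IsTestFunction U φ ∧ k.fst =ᵐ[volume] φ ∧ k.snd =ᵐ[volume] gradient φ}
  zero_mem' := by
    refine ⟨_, IsTestFunction.zero, ?_, ?_⟩
    · exact Lp.coeFn_zero _ _ _
    · have : gradient (fun _ : E d => (0 : ℝ)) = 0 := by ext1 x; simp [gradient]
      rw [this]
      exact Lp.coeFn_zero _ _ _
  add_mem' := by
    rintro a b ⟨φ, hφ, ha1, ha2⟩ ⟨ψ, hψ, hb1, hb2⟩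
    refine ⟨_, hφ.add hψ, ?_, ?_⟩
    · filter_upwards [Lp.coeFn_add a.fst b.fst, ha1, hb1] with x h h1 h2
      rw [WithLp.add_fst, h, Pi.add_apply, h1, h2]
    · filter_upwards [Lp.coeFn_add a.snd b.snd, ha2, hb2] with x h h1 h2
      rw [gradient_add_apply hφ.differentiable hψ.differentiable, WithLp.add_snd, h, Pi.add_apply,
        h1, h2]
  smul_mem' := by
    rintro c a ⟨φ, hφ, ha1, ha2⟩
    refine ⟨_, hφ.const_mul c, ?_, ?_⟩
    · filter_upwards [Lp.coeFn_smul c a.fst, ha1] with x h h1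
      simp [h, h1]
    · filter_upwards [Lp.coeFn_smul c a.snd, ha2] with x h h1
      rw [gradient_const_mul_apply hφ.differentiable]
      simp [h, h1]

/-- The pair `(φ, ∇φ)` of a test function. -/
noncomputable def IsTestFunction.pair {U : Set (E d)} {φ : E d → ℝ} (hφ : IsTestFunction U φ) :
    PairSpace d :=
  WithLp.toLp 2 (hφ.memLp.toLp φ, hφ.memLp_gradient.toLp (gradient φ))

theorem IsTestFunction.pair_mem {U : Set (E d)} {φ : E d → ℝ} (hφ : IsTestFunction U φ) :
    hφ.pair ∈ testPairs U :=
  ⟨φ, hφ, hφ.memLp.coeFn_toLp, hφ.memLp_gradient.coeFn_toLp⟩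

theorem exists_pair_of_mem_testPairs {U : Set (E d)} {k : PairSpace d} (hk : k ∈ testPairs U) :
    ∃ φ, ∃ hφ : IsTestFunction U φ, k = hφ.pair := by
  obtain ⟨φ, hφ, h1, h2⟩ := hk
  refine ⟨φ, hφ, ?_⟩
  apply (WithLp.ofLp_injective 2)
  refine Prod.ext ?_ ?_
  · exact Lp.ext (h1.trans hφ.memLp.coeFn_toLp.symm)
  · exact Lp.ext (h2.trans hφ.memLp_gradient.coeFn_toLp.symm)

theorem tendsto_pairSpace_iff {f : ℕ → PairSpace d} {k : PairSpace d} :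
    Tendsto f atTop (𝓝 k) ↔ Tendsto (fun n => (f n).fst) atTop (𝓝 k.fst) ∧
      Tendsto (fun n => (f n).snd) atTop (𝓝 k.snd) := by
  constructor
  · intro h
    exact ⟨((WithLp.fstL 2 ℝ _ _).continuous.tendsto k).comp h,
      ((WithLp.sndL 2 ℝ _ _).continuous.tendsto k).comp h⟩
  · rintro ⟨h1, h2⟩
    have := (WithLp.prod_continuous_toLp 2 (Lp ℝ 2 (volume : Measure (E d)))
      (Lp (E d) 2 (volume : Measure (E d)))).tendsto (k.fst, k.snd)
    exact this.comp (h1.prodMk_nhds h2)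

/-- The pairs of `MemH10With` are the elements of the closure of the test pairs. -/
theorem memH10With_iff {U : Set (E d)} {u : E d → ℝ} {g : E d → E d} :
    MemH10With U u g ↔ ∃ k ∈ (testPairs U).topologicalClosure,
      k.fst =ᵐ[volume] u ∧ k.snd =ᵐ[volume] g := by
  constructor
  · rintro ⟨hu, hg, φ, hφ, h1, h2⟩
    refine ⟨WithLp.toLp 2 (hu.toLp u, hg.toLp g), ?_, hu.coeFn_toLp, hg.coeFn_toLp⟩
    rw [← SetLike.mem_coe, Submodule.topologicalClosure_coe, mem_closure_iff_seq_limit]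
    refine ⟨fun n => (hφ n).pair, fun n => (hφ n).pair_mem, tendsto_pairSpace_iff.2 ⟨?_, ?_⟩⟩
    · exact (Lp.tendsto_Lp_iff_tendsto_eLpNorm'' φ (fun n => (hφ n).memLp) u hu).2 h1
    · exact (Lp.tendsto_Lp_iff_tendsto_eLpNorm'' (fun n => gradient (φ n))
        (fun n => (hφ n).memLp_gradient) g hg).2 h2
  · rintro ⟨k, hk, h1, h2⟩
    have hu : MemLp u 2 volume := (memLp_congr_ae h1).1 (Lp.memLp _)
    have hg : MemLp g 2 volume := (memLp_congr_ae h2).1 (Lp.memLp _)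
    rw [← SetLike.mem_coe, Submodule.topologicalClosure_coe, mem_closure_iff_seq_limit] at hk
    obtain ⟨x, hx, hlim⟩ := hk
    choose φ hφ hxφ using fun n => exists_pair_of_mem_testPairs (hx n)
    obtain rfl : x = fun n => (hφ n).pair := funext hxφ
    obtain ⟨l1, l2⟩ := tendsto_pairSpace_iff.1 hlim
    refine ⟨hu, hg, φ, hφ, ?_, ?_⟩
    · refine (Lp.tendsto_Lp_iff_tendsto_eLpNorm'' φ (fun n => (hφ n).memLp) u hu).1 ?_
      have e : hu.toLp u = k.fst := Lp.ext (hu.coeFn_toLp.trans h1.symm)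
      rw [e]
      exact l1
    · refine (Lp.tendsto_Lp_iff_tendsto_eLpNorm'' (fun n => gradient (φ n))
        (fun n => (hφ n).memLp_gradient) g hg).1 ?_
      have e : hg.toLp g = k.snd := Lp.ext (hg.coeFn_toLp.trans h2.symm)
      rw [e]
      exact l2

theorem norm_sq_toLp_eq_integral {F : Type*} [NormedAddCommGroup F] [InnerProductSpace ℝ F]
    {f : E d → F} (hf : MemLp f 2 volume) : ‖hf.toLp f‖ ^ 2 = ∫ x, ‖f x‖ ^ 2 := by
  rw [← real_inner_self_eq_norm_sq, L2.inner_def]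
  refine integral_congr_ae ?_
  filter_upwards [hf.coeFn_toLp] with x hx
  rw [hx, real_inner_self_eq_norm_sq]

/-! ### Weak solutions and the variational formula for the compliance. -/

variable {S Ω : Set (E d)}

theorem norm_fst_sq_le_of_mem_closure {U : Set (E d)} {C : ℝ}
    (hC : ∀ φ : E d → ℝ, IsTestFunction U φ → ∫ x, φ x ^ 2 ≤ C * ∫ x, ‖gradient φ x‖ ^ 2)
    {k : PairSpace d} (hk : k ∈ (testPairs U).topologicalClosure) :
    ‖k.fst‖ ^ 2 ≤ C * ‖k.snd‖ ^ 2 := by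
  have hcl : IsClosed {k : PairSpace d | ‖k.fst‖ ^ 2 ≤ C * ‖k.snd‖ ^ 2} :=
    isClosed_le ((WithLp.fstL 2 ℝ _ _).continuous.norm.pow 2)
      (continuous_const.mul ((WithLp.sndL 2 ℝ _ _).continuous.norm.pow 2))
  refine closure_minimal ?_ hcl hk
  intro w hw
  obtain ⟨φ, hφ, rfl⟩ := exists_pair_of_mem_testPairs hw
  change ‖hφ.memLp.toLp φ‖ ^ 2 ≤ C * ‖hφ.memLp_gradient.toLp (gradient φ)‖ ^ 2
  rw [norm_sq_toLp_eq_integral, norm_sq_toLp_eq_integral]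
  simpa using hC φ hφ

/-- Gradients of test functions vanish off `Ω`, and the identity is a closed condition on `w`. It
lets integrals over `Ω` in the weak formulation be read as inner products of `L²(ℝ^d)`. -/
theorem setIntegral_inner_of_mem_closure (hΩ : MeasurableSet Ω)
    (g : Lp (E d) 2 (volume : Measure (E d)))
    {w : PairSpace d} (hw : w ∈ (testPairs (Ω \ S)).topologicalClosure) :
    ∫ x in Ω, inner ℝ (g x) (w.snd x) = inner ℝ g w.snd := by
  have hg : MemLp (Ω.indicator g) 2 volume := (Lp.memLp g).indicator hΩ
  have key : ∀ w : PairSpace d,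
      ∫ x in Ω, inner ℝ (g x) (w.snd x) = inner ℝ (hg.toLp _) w.snd := by
    intro w
    rw [L2.inner_def, ← integral_indicator hΩ]
    refine integral_congr_ae ?_
    filter_upwards [hg.coeFn_toLp] with x hx
    rw [hx]
    by_cases h : x ∈ Ω <;> simp [h]
  rw [key]
  have hcl : IsClosed {w : PairSpace d | inner ℝ (hg.toLp _) w.snd = inner ℝ g w.snd} :=
    isClosed_eq (continuous_const.inner (WithLp.sndL 2 ℝ _ _).continuous)
      (continuous_const.inner (WithLp.sndL 2 ℝ _ _).continuous)
  refine closure_minimal ?_ hcl hw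
  intro w hw
  change inner ℝ (hg.toLp _) w.snd = inner ℝ g w.snd
  rw [← key, L2.inner_def]
  obtain ⟨φ, hφ, h1, h2⟩ := hw
  have e : ∀ A : Set (E d), ∫ x in A, inner ℝ (g x) (w.snd x) =
      ∫ x in A, inner ℝ (g x) (gradient φ x) := by
    intro A
    refine integral_congr_ae (ae_restrict_of_ae ?_)
    filter_upwards [h2] with x hx
    rw [hx]
  have e2 := e univ
  rw [setIntegral_univ, setIntegral_univ] at e2
  rw [e, e2]
  refine setIntegral_eq_integral_of_forall_compl_eq_zero fun x hx => ?_
  rw [hφ.gradient_eq_zero fun h => hx h.1, inner_zero_right]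

/-- The Lax-Milgram theorem in the closure of the test pairs. -/
theorem exists_weak_pair {U : Set (E d)} {C : ℝ}
    (hC : ∀ φ : E d → ℝ, IsTestFunction U φ → ∫ x, φ x ^ 2 ≤ C * ∫ x, ‖gradient φ x‖ ^ 2)
    (ℓ : Lp ℝ 2 (volume : Measure (E d))) :
    ∃ k ∈ (testPairs U).topologicalClosure, ∀ w ∈ (testPairs U).topologicalClosure,
      inner ℝ k.snd w.snd = inner ℝ ℓ w.fst := by
  set V := (testPairs U).topologicalClosure with hV
  have : CompleteSpace V := (Submodule.isClosed_topologicalClosure _).completeSpace_coe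
  let sn : V →L[ℝ] Lp (E d) 2 (volume : Measure (E d)) := (WithLp.sndL 2 ℝ _ _).comp V.subtypeL
  let fs : V →L[ℝ] Lp ℝ 2 (volume : Measure (E d)) := (WithLp.fstL 2 ℝ _ _).comp V.subtypeL
  let B : V →L[ℝ] V →L[ℝ] ℝ :=
    (innerSL ℝ (E := Lp (E d) 2 (volume : Measure (E d)))).bilinearComp sn sn
  have hB : ∀ v w, B v w = inner ℝ (v : PairSpace d).snd (w : PairSpace d).snd := fun v w => rfl
  have hco : IsCoercive B := by
    -- By Poincaré, `‖v‖² = ‖fst‖² + ‖snd‖² ≤ (1 + |C|) ‖snd‖²`; the absolute value keeps the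
    -- constant positive whatever the sign of `C`.
    refine ⟨(1 + |C|)⁻¹, by positivity, fun v => ?_⟩
    rw [hB, real_inner_self_eq_norm_sq, mul_assoc, inv_mul_le_iff₀ (by positivity)]
    have h1 := norm_fst_sq_le_of_mem_closure hC v.2
    have h2 : ‖v‖ * ‖v‖ = ‖(v : PairSpace d).fst‖ ^ 2 + ‖(v : PairSpace d).snd‖ ^ 2 := by
      rw [← sq, Submodule.coe_norm, WithLp.prod_norm_sq_eq_of_L2]
    have h3 := mul_le_mul_of_nonneg_right (le_abs_self C) (sq_nonneg ‖(v : PairSpace d).snd‖)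
    rw [h2]
    linarith
  let L : V →L[ℝ] ℝ := (innerSL ℝ ℓ).comp fs
  have hL : ∀ w : V, L w = inner ℝ ℓ (w : PairSpace d).fst := fun w => rfl
  let k := hco.continuousLinearEquivOfBilin.symm ((InnerProductSpace.toDual ℝ V).symm L)
  refine ⟨k, k.2, fun w hw => ?_⟩
  have h := hco.continuousLinearEquivOfBilin_apply k ⟨w, hw⟩
  rw [hB] at h
  rw [← h]
  simp only [k, ContinuousLinearEquiv.apply_symm_apply, InnerProductSpace.toDual_symm_apply]
  exact hL ⟨w, hw⟩

theorem inner_indicator_one (hΩ : MeasurableSet Ω) (hfin : volume Ω ≠ ⊤)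
    (w : Lp ℝ 2 (volume : Measure (E d))) :
    inner ℝ (indicatorConstLp 2 hΩ hfin (1 : ℝ)) w = ∫ x in Ω, w x :=
  L2.inner_indicatorConstLp_one hΩ hfin w

theorem exists_isWeakSolution (hΩ : MeasurableSet Ω) (hfin : volume Ω ≠ ⊤) {C : ℝ}
    (hC : ∀ φ : E d → ℝ, IsTestFunction (Ω \ S) φ →
      ∫ x, φ x ^ 2 ≤ C * ∫ x, ‖gradient φ x‖ ^ 2) :
    ∃ u, IsWeakSolution (fun _ => 1) S Ω u := by
  obtain ⟨k, hk, h⟩ := exists_weak_pair hC (indicatorConstLp 2 hΩ hfin (1 : ℝ))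
  refine ⟨k.fst, k.snd, memH10With_iff.2 ⟨k, hk, ae_eq_refl _, ae_eq_refl _⟩, fun φ g hφ => ?_⟩
  obtain ⟨w, hw, h1, h2⟩ := memH10With_iff.1 hφ
  have := h w hw
  rw [inner_indicator_one, ← setIntegral_inner_of_mem_closure hΩ _ hw] at this
  convert this using 1
  · refine integral_congr_ae (ae_restrict_of_ae ?_)
    filter_upwards [h2] with x hx
    rw [hx]
  · refine integral_congr_ae (ae_restrict_of_ae ?_)
    filter_upwards [h1] with x hx
    rw [hx, one_mul]

theorem IsWeakSolution.exists_weak_pair (hΩ : MeasurableSet Ω) (hfin : volume Ω ≠ ⊤)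
    {u : E d → ℝ} (hu : IsWeakSolution (fun _ => 1) S Ω u) :
    ∃ k ∈ (testPairs (Ω \ S)).topologicalClosure, k.fst =ᵐ[volume] u ∧
      ∀ w ∈ (testPairs (Ω \ S)).topologicalClosure,
        inner ℝ k.snd w.snd = inner ℝ (indicatorConstLp 2 hΩ hfin (1 : ℝ)) w.fst := by
  obtain ⟨g, hg, h⟩ := hu
  obtain ⟨k, hk, h1, h2⟩ := memH10With_iff.1 hg
  refine ⟨k, hk, h1, fun w hw => ?_⟩
  have := h w.fst w.snd (memH10With_iff.2 ⟨w, hw, ae_eq_refl _, ae_eq_refl _⟩)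
  rw [inner_indicator_one, ← setIntegral_inner_of_mem_closure hΩ _ hw]
  simp only [one_mul] at this
  rw [← this]
  refine integral_congr_ae (ae_restrict_of_ae ?_)
  filter_upwards [h2] with x hx
  rw [hx]

/-- The compliance is the supremum of the energies of the test functions. -/
theorem isLUB_energy_compliance (hΩ : MeasurableSet Ω) (hfin : volume Ω ≠ ⊤) {C : ℝ}
    (hC : ∀ φ : E d → ℝ, IsTestFunction (Ω \ S) φ →
      ∫ x, φ x ^ 2 ≤ C * ∫ x, ‖gradient φ x‖ ^ 2) :
    IsLUB {a | ∃ φ, IsTestFunction (Ω \ S) φ ∧ a = energy φ} (compliance S (fun _ => 1) Ω) := by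
  have hex := exists_isWeakSolution hΩ hfin hC
  have hsol : IsWeakSolution (fun _ => 1) S Ω (solution (fun _ => 1) S Ω) := by
    unfold solution
    rw [dif_pos hex]
    exact hex.choose_spec
  obtain ⟨k, hk, h1, h⟩ := hsol.exists_weak_pair hΩ hfin
  set ℓ := indicatorConstLp 2 hΩ hfin (1 : ℝ) with hℓ
  have hF : compliance S (fun _ => 1) Ω = inner ℝ ℓ k.fst := by
    unfold compliance
    rw [inner_indicator_one]
    refine integral_congr_ae (ae_restrict_of_ae ?_)
    filter_upwards [h1] with x hx
    rw [hx, one_mul]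
  have henergy : ∀ φ, ∀ hφ : IsTestFunction (Ω \ S) φ,
      energy φ = 2 * inner ℝ ℓ hφ.pair.fst - ‖hφ.pair.snd‖ ^ 2 := by
    intro φ hφ
    unfold energy
    rw [inner_indicator_one]
    change _ = (2 * ∫ x in Ω, hφ.memLp.toLp φ x) - ‖hφ.memLp_gradient.toLp (gradient φ)‖ ^ 2
    rw [norm_sq_toLp_eq_integral, ← hφ.setIntegral_eq (sdiff_subset : Ω \ S ⊆ Ω)]
    congr 2
    refine integral_congr_ae (ae_restrict_of_ae ?_)
    filter_upwards [hφ.memLp.coeFn_toLp] with x hx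
    rw [hx]
  constructor
  · rintro a ⟨φ, hφ, rfl⟩
    have hm := (testPairs (Ω \ S)).le_topologicalClosure hφ.pair_mem
    -- Testing the weak equation with `φ` and with the solution turns the claim into `2⟨∇u, ∇φ⟩ -
    -- ‖∇φ‖² ≤ ‖∇u‖²`.
    rw [henergy φ hφ, hF, ← h _ hm, ← h _ hk, real_inner_self_eq_norm_sq]
    have := sq_nonneg ‖k.snd - hφ.pair.snd‖
    rw [norm_sub_sq_real] at this
    linarith
  · intro b hb
    -- The energy is continuous on pairs, so an upper bound on test pairs passes to the closure, in
    -- particular to the solution, whose energy is the compliance.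
    have hcl : IsClosed {w : PairSpace d | 2 * inner ℝ ℓ w.fst - ‖w.snd‖ ^ 2 ≤ b} :=
      isClosed_le ((continuous_const.mul
        (continuous_const.inner (WithLp.fstL 2 ℝ _ _).continuous)).sub
        ((WithLp.sndL 2 ℝ _ _).continuous.norm.pow 2)) continuous_const
    have hsub : (testPairs (Ω \ S) : Set (PairSpace d)) ⊆
        {w : PairSpace d | 2 * inner ℝ ℓ w.fst - ‖w.snd‖ ^ 2 ≤ b} := by
      intro w hw
      obtain ⟨φ, hφ, rfl⟩ := exists_pair_of_mem_testPairs hw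
      change 2 * inner ℝ ℓ hφ.pair.fst - ‖hφ.pair.snd‖ ^ 2 ≤ b
      rw [← henergy φ hφ]
      exact hb ⟨φ, hφ, rfl⟩
    have hkb : 2 * inner ℝ ℓ k.fst - ‖k.snd‖ ^ 2 ≤ b := closure_minimal hsub hcl hk
    have e := h k hk
    rw [real_inner_self_eq_norm_sq] at e
    rw [hF]
    linarith

/-! ### A Poincaré inequality by integration along segments -/

/-- Cauchy–Schwarz against the constant 1, from the expansion of `∫ (V p - m)² ≥ 0`, with `V` the
total mass and `m` the integral of `p`. -/
theorem sq_setIntegral_le {α : Type*} [MeasurableSpace α] {μ : Measure α} [IsFiniteMeasure μ]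
    {p : α → ℝ} (h1 : Integrable p μ) (h2 : Integrable (fun x => p x ^ 2) μ) :
    (∫ x, p x ∂μ) ^ 2 ≤ μ.real univ * ∫ x, p x ^ 2 ∂μ := by
  set m := ∫ x, p x ∂μ with hm
  set V := μ.real univ with hV
  have h : 0 ≤ ∫ x, (V * p x - m) ^ 2 ∂μ := integral_nonneg fun x => sq_nonneg _
  have e : ∀ x, (V * p x - m) ^ 2 = V ^ 2 * p x ^ 2 - 2 * V * m * p x + m ^ 2 := fun x => by ring
  simp_rw [e] at h
  have i1 : Integrable (fun x => V ^ 2 * p x ^ 2 - 2 * V * m * p x) μ :=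
    (h2.const_mul _).sub (h1.const_mul _)
  rw [integral_add i1 (integrable_const _), integral_sub (h2.const_mul _) (h1.const_mul _), integral_const_mul, integral_const_mul,
    integral_const, ← hm, ← hV, smul_eq_mul] at h
  have hV0 : 0 ≤ V := measureReal_nonneg
  rcases hV0.eq_or_lt with h0 | h0
  · have : μ = 0 := by
      rw [← Measure.measure_univ_eq_zero]
      exact (measureReal_eq_zero_iff).1 h0.symm
    have : m = 0 := by simp [hm, this]
    rw [this, ← h0]
    simp
  · have : 0 ≤ V * (V * ∫ x, p x ^ 2 ∂μ - m ^ 2) := by nlinarith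
    have := nonneg_of_mul_nonneg_right this h0
    linarith

/-- Fundamental theorem of calculus from the zero of `φ` on the line to `x`, then Cauchy–Schwarz.
The interval is enlarged to `(-L, L]`, which no longer depends on `x`, so that Fubini applies when
integrating in `x`. -/
theorem IsTestFunction.sq_le_setIntegral {U : Set (E d)} {φ : E d → ℝ} (hφ : IsTestFunction U φ)
    {e : E d} (he : ‖e‖ = 1) {L : ℝ} {x : E d}
    {t : ℝ} (ht : |t| ≤ L) (h0 : φ (x + t • e) = 0) :
    φ x ^ 2 ≤ 2 * L * ∫ s in Ioc (-L) L, ‖gradient φ (x + s • e)‖ ^ 2 := by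
  have hL : 0 ≤ L := (abs_nonneg t).trans ht
  have hcg : Continuous fun s : ℝ => gradient φ (x + s • e) :=
    hφ.continuous_gradient.comp (by fun_prop)
  have hcont : Continuous fun s : ℝ => inner ℝ (gradient φ (x + s • e)) e :=
    hcg.inner continuous_const
  have hder : ∀ s : ℝ, HasDerivAt (fun s : ℝ => φ (x + s • e))
      (inner ℝ (gradient φ (x + s • e)) e) s := by
    intro s
    have h1 : HasDerivAt (fun s : ℝ => x + s • e) e s := by
      simpa using ((hasDerivAt_id s).smul_const e).const_add x
    have h2 := ((hφ.differentiable (x + s • e)).hasFDerivAt).comp_hasDerivAt s h1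
    rwa [← inner_gradient_left] at h2
  have hint := intervalIntegral.integral_eq_sub_of_hasDerivAt (a := t) (b := 0)
    (fun s _ => hder s) (hcont.intervalIntegrable _ _)
  simp only [zero_smul, add_zero, h0, sub_zero] at hint
  have hsub : uIoc t 0 ⊆ Ioc (-L) L := by
    intro s hs
    obtain ⟨h1, h2⟩ := abs_le.1 ht
    rw [mem_uIoc] at hs
    rcases hs with ⟨a, b⟩ | ⟨a, b⟩
    · exact ⟨by linarith, by linarith⟩
    · exact ⟨by linarith, by linarith⟩
  have hi1 : IntegrableOn (fun s : ℝ => ‖gradient φ (x + s • e)‖) (Ioc (-L) L) :=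
    (hcg.norm.continuousOn.integrableOn_Icc).mono_set Ioc_subset_Icc_self
  have hi2 : IntegrableOn (fun s : ℝ => ‖gradient φ (x + s • e)‖ ^ 2) (Ioc (-L) L) :=
    ((hcg.norm.pow 2).continuousOn.integrableOn_Icc).mono_set Ioc_subset_Icc_self
  have habs : |φ x| ≤ ∫ s in Ioc (-L) L, ‖gradient φ (x + s • e)‖ := by
    rw [← hint, ← Real.norm_eq_abs]
    refine (intervalIntegral.norm_integral_le_integral_norm_uIoc).trans ?_
    refine le_trans ?_ (setIntegral_mono_set hi1 (ae_of_all _ fun s => norm_nonneg _)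
      hsub.eventuallyLE)
    refine setIntegral_mono ?_ (hi1.mono_set hsub) fun s => ?_
    · exact ((hcont.norm.continuousOn.integrableOn_Icc).mono_set Ioc_subset_Icc_self).mono_set hsub
    · have := abs_real_inner_le_norm (gradient φ (x + s • e)) e
      rwa [he, mul_one] at this
  have hcs := sq_setIntegral_le (μ := volume.restrict (Ioc (-L) L)) hi1 hi2
  have hvol : (volume.restrict (Ioc (-L) L)).real univ = 2 * L := by
    rw [measureReal_restrict_apply MeasurableSet.univ, univ_inter, Real.volume_real_Ioc]
    rw [max_eq_left (by linarith)]
    ring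
  rw [hvol] at hcs
  refine le_trans ?_ hcs
  rw [← sq_abs]
  exact pow_le_pow_left₀ (abs_nonneg _) habs 2

theorem IsTestFunction.integral_sq_le {U : Set (E d)} {φ : E d → ℝ} (hφ : IsTestFunction U φ)
    {e : E d} (he : ‖e‖ = 1) {L : ℝ} (hL : 0 ≤ L)
    (h : ∀ x ∈ U, ∃ t : ℝ, |t| ≤ L ∧ φ (x + t • e) = 0) :
    ∫ x, φ x ^ 2 ≤ 4 * L ^ 2 * ∫ x, ‖gradient φ x‖ ^ 2 := by
  set f : E d → ℝ := fun x => ‖gradient φ x‖ ^ 2 with hf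
  have hfc : Continuous f := hφ.continuous_gradient.norm.pow 2
  have hfi : Integrable f := hφ.integrable_norm_gradient_sq
  set μ := (volume : Measure ℝ).restrict (Ioc (-L) L) with hμ
  have hμv : μ.real univ = 2 * L := by
    rw [hμ, measureReal_restrict_apply MeasurableSet.univ, univ_inter, Real.volume_real_Ioc]
    rw [max_eq_left (by linarith)]
    ring
  have hint : ∀ s : ℝ, Integrable fun x => f (x + s • e) := fun s => hfi.comp_add_right _
  have hprod : Integrable (fun z : E d × ℝ => f (z.1 + z.2 • e)) (volume.prod μ) := by
    rw [integrable_prod_iff']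
    · refine ⟨ae_of_all _ hint, ?_⟩
      have : ∀ s : ℝ, ∫ x, ‖f (x + s • e)‖ = ∫ x, ‖f x‖ := fun s =>
        integral_add_right_eq_self (fun x => ‖f x‖) (s • e)
      simp_rw [this]
      exact integrable_const _
    · exact (hfc.comp (by fun_prop)).aestronglyMeasurable
  -- Each translate of `f` has the same integral, so Fubini yields a second factor `2L`.
  have hswap : ∫ x, ∫ s, f (x + s • e) ∂μ = 2 * L * ∫ x, f x := by
    rw [integral_integral_swap hprod]
    have : ∀ s : ℝ, ∫ x, f (x + s • e) = ∫ x, f x := fun s =>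
      integral_add_right_eq_self f (s • e)
    simp_rw [this]
    rw [integral_const, hμv, smul_eq_mul]
  calc ∫ x, φ x ^ 2 ≤ ∫ x, 2 * L * ∫ s, f (x + s • e) ∂μ := by
        refine integral_mono hφ.integrable_sq (hprod.integral_prod_left.const_mul _) fun x => ?_
        by_cases hx : x ∈ U
        · obtain ⟨t, ht, h0⟩ := h x hx
          exact hφ.sq_le_setIntegral he ht h0
        · change φ x ^ 2 ≤ 2 * L * ∫ s, f (x + s • e) ∂μ
          rw [hφ.eq_zero hx, zero_pow two_ne_zero]
          have : 0 ≤ ∫ s, f (x + s • e) ∂μ := integral_nonneg fun s => sq_nonneg _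
          exact mul_nonneg (mul_nonneg zero_le_two hL) this
    _ = 4 * L ^ 2 * ∫ x, f x := by
        rw [integral_const_mul, hswap]
        ring

/-! ### The unit cube -/

theorem isOpen_unitCube : IsOpen (unitCube d) := by
  have : unitCube d = ⋂ i, (fun x : E d => x i) ⁻¹' Ioo (0 : ℝ) 1 := by
    ext x; simp [unitCube]
  rw [this]
  exact isOpen_iInter_of_finite fun i => isOpen_Ioo.preimage (by fun_prop)

theorem volume_unitCube : volume (unitCube d) = 1 := by
  have e : unitCube d = (MeasurableEquiv.toLp 2 (Fin d → ℝ)).symm ⁻¹'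
      (univ.pi fun _ : Fin d => Ioo (0 : ℝ) 1) := by
    ext x
    simp [unitCube]
  rw [e, (EuclideanSpace.volume_preserving_symm_measurableEquiv_toLp (Fin d)).measure_preimage_equiv,
    Real.volume_pi_Ioo]
  simp

theorem measurableSet_unitCube : MeasurableSet (unitCube d) := isOpen_unitCube.measurableSet

theorem exists_shift_notMem_unitCube (i : Fin d) (x : E d) (hx : x ∈ unitCube d) :
    ∃ t : ℝ, |t| ≤ 1 ∧ x + t • EuclideanSpace.single i (1 : ℝ) ∉ unitCube d := by
  refine ⟨1, by simp, fun h => ?_⟩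
  have h1 := (h i).2
  have h2 := (hx i).1
  simp at h1
  linarith

theorem norm_single_one (i : Fin d) : ‖(EuclideanSpace.single i (1 : ℝ) : E d)‖ = 1 := by simp

theorem poincare_unitCube (hd : 1 ≤ d) {U : Set (E d)} (hU : U ⊆ unitCube d) {φ : E d → ℝ}
    (hφ : IsTestFunction U φ) : ∫ x, φ x ^ 2 ≤ 4 * ∫ x, ‖gradient φ x‖ ^ 2 := by
  have := hφ.integral_sq_le (norm_single_one ⟨0, hd⟩) zero_le_one fun x hx => by
    obtain ⟨t, ht, h⟩ := exists_shift_notMem_unitCube ⟨0, hd⟩ x (hU hx)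
    exact ⟨t, ht, hφ.eq_zero fun hm => h (hU hm)⟩
  simpa using this

/-- The compliance in the unit cube. -/
noncomputable abbrev cubeCompliance (S : Set (E d)) : ℝ :=
  compliance S (fun _ => 1) (unitCube d)

theorem isLUB_cubeCompliance (hd : 1 ≤ d) (S : Set (E d)) :
    IsLUB {a | ∃ φ, IsTestFunction (unitCube d \ S) φ ∧ a = energy φ} (cubeCompliance S) :=
  isLUB_energy_compliance measurableSet_unitCube (by simp [volume_unitCube])
    fun _ hφ => poincare_unitCube hd sdiff_subset hφ

theorem energy_le_cubeCompliance (hd : 1 ≤ d) {S : Set (E d)} {φ : E d → ℝ}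
    (hφ : IsTestFunction (unitCube d \ S) φ) : energy φ ≤ cubeCompliance S :=
  (isLUB_cubeCompliance hd S).1 ⟨φ, hφ, rfl⟩

theorem cubeCompliance_le (hd : 1 ≤ d) {S : Set (E d)} {b : ℝ}
    (h : ∀ φ : E d → ℝ, IsTestFunction (unitCube d \ S) φ → energy φ ≤ b) :
    cubeCompliance S ≤ b := by
  refine (isLUB_cubeCompliance hd S).2 ?_
  rintro a ⟨φ, hφ, rfl⟩
  exact h φ hφ

theorem cubeCompliance_nonneg (hd : 1 ≤ d) (S : Set (E d)) : 0 ≤ cubeCompliance S := by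
  refine le_trans (le_of_eq ?_) (energy_le_cubeCompliance hd IsTestFunction.zero)
  simp [energy, gradient]

/-- If every segment of half-length `L` in a coordinate direction centred in the cube meets `S`,
the compliance is at most `4 L²`. -/
theorem cubeCompliance_le_of_shift (i : Fin d) {S : Set (E d)} {L : ℝ} (hL : 0 < L)
    (h : ∀ x ∈ unitCube d, ∃ t : ℝ, |t| ≤ L ∧ x + t • EuclideanSpace.single i (1 : ℝ) ∈ S) :
    cubeCompliance S ≤ 4 * L ^ 2 := by
  refine cubeCompliance_le (by have := i.2; omega) fun φ hφ => ?_
  have hp := hφ.integral_sq_le (norm_single_one i) hL.le fun x hx => by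
    obtain ⟨t, ht, hS⟩ := h x hx.1
    exact ⟨t, ht, hφ.eq_zero fun hm => hm.2 hS⟩
  -- Young's inequality, weighted so that the quadratic term is exactly what the Poincaré constant
  -- `4 L²` absorbs into the Dirichlet energy; the cube has volume 1.
  have h2 : 2 * ∫ x, φ x ≤ ((4 * L ^ 2)⁻¹ * ∫ x, φ x ^ 2) + 4 * L ^ 2 := by
    have hv : volume.real (unitCube d) = 1 := by simp [measureReal_def, volume_unitCube]
    have hfinite : IsFiniteMeasure (volume.restrict (unitCube d)) :=
      ⟨by simp [volume_unitCube]⟩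
    have e2 : ∫ x in unitCube d, φ x ^ 2 = ∫ x, φ x ^ 2 :=
      setIntegral_eq_integral_of_forall_compl_eq_zero fun x hx => by
        rw [hφ.eq_zero fun h => hx h.1]; simp
    rw [← hφ.setIntegral_eq (sdiff_subset : _ ⊆ unitCube d), ← e2, ← integral_const_mul,
      ← integral_const_mul]
    have e3 : (4 * L ^ 2) = ∫ _ in unitCube d, 4 * L ^ 2 := by
      rw [setIntegral_const, hv, one_smul]
    refine le_of_le_of_eq (b := ∫ x in unitCube d, ((4 * L ^ 2)⁻¹ * φ x ^ 2 + 4 * L ^ 2)) ?_ ?_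
    swap
    · rw [integral_add (hφ.integrable_sq.integrableOn.const_mul _) (integrable_const _), ← e3]
    refine setIntegral_mono (hφ.integrable.integrableOn.const_mul _)
      ((hφ.integrable_sq.integrableOn.const_mul _).add (integrable_const _)) fun x => ?_
    have : 0 ≤ (4 * L ^ 2)⁻¹ * (φ x - 4 * L ^ 2) ^ 2 := by positivity
    have e : (4 * L ^ 2)⁻¹ * (φ x - 4 * L ^ 2) ^ 2 =
        (4 * L ^ 2)⁻¹ * φ x ^ 2 - 2 * φ x + 4 * L ^ 2 := by
      field_simp
      ring
    change 2 * φ x ≤ (4 * L ^ 2)⁻¹ * φ x ^ 2 + 4 * L ^ 2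
    linarith
  have h3 : (4 * L ^ 2)⁻¹ * ∫ x, φ x ^ 2 ≤ ∫ x, ‖gradient φ x‖ ^ 2 := by
    rw [inv_mul_le_iff₀ (by positivity)]
    exact hp
  unfold energy
  linarith

theorem cubeCompliance_eq_zero_of_subset (hd : 1 ≤ d) {S : Set (E d)} (h : unitCube d ⊆ S) :
    cubeCompliance S = 0 := by
  refine le_antisymm (cubeCompliance_le hd fun φ hφ => ?_) (cubeCompliance_nonneg hd S)
  have : φ = fun _ => 0 := funext fun x => hφ.eq_zero fun hm => hm.2 (h hm.1)
  subst this
  simp [energy, gradient]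

/-! ### Mollification of Lipschitz functions -/

open scoped NNReal Convolution in
-- Averaging against a probability density supported in a `δ`-ball keeps the Lipschitz constant and
-- every bound `|f - c| ≤ ε` valid on that ball. With `ε = 0` it preserves locally constant values;
-- with `c = ε` it preserves a range `[0, 2c]`.
theorem exists_contDiff_lipschitzWith {f : E d → ℝ} {K : ℝ≥0} (hf : LipschitzWith K f) {δ : ℝ}
    (hδ : 0 < δ) : ∃ g : E d → ℝ, ContDiff ℝ ∞ g ∧ LipschitzWith K g ∧
      ∀ (x : E d) (c ε : ℝ), (∀ y ∈ Metric.ball x δ, |f y - c| ≤ ε) → |g x - c| ≤ ε := by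
  let ρ : ContDiffBump (0 : E d) := ⟨δ / 2, δ, by linarith, by linarith⟩
  let k : E d → ℝ := ρ.normed volume
  have hk : ContDiff ℝ ∞ k := ρ.contDiff_normed
  have hkc : HasCompactSupport k := ρ.hasCompactSupport_normed
  have hk0 : ∀ x, 0 ≤ k x := ρ.nonneg_normed
  have hk1 : ∫ x, k x = 1 := ρ.integral_normed
  have hki : Integrable k := hk.continuous.integrable_of_hasCompactSupport hkc
  refine ⟨k ⋆[ContinuousLinearMap.lsmul ℝ ℝ, volume] f, ?_, ?_, ?_⟩
  · exact hkc.contDiff_convolution_left _ hk hf.continuous.locallyIntegrable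
  · refine LipschitzWith.of_dist_le_mul fun x y => ?_
    have hi : ∀ x : E d, Integrable fun t => k t * f (x - t) := fun x =>
      (hk.continuous.mul (hf.continuous.comp (by fun_prop))).integrable_of_hasCompactSupport
        hkc.mul_right
    rw [Real.dist_eq, convolution_def, convolution_def]
    simp only [ContinuousLinearMap.lsmul_apply, smul_eq_mul]
    rw [← integral_sub (hi x) (hi y), ← Real.norm_eq_abs]
    calc ‖∫ t, k t * f (x - t) - k t * f (y - t)‖ ≤ ∫ t, k t * (K * dist x y) := by
          refine norm_integral_le_of_norm_le (hki.mul_const _) (ae_of_all _ fun t => ?_)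
          rw [← mul_sub, norm_mul, Real.norm_of_nonneg (hk0 t)]
          refine mul_le_mul_of_nonneg_left ?_ (hk0 t)
          have := hf.dist_le_mul (x - t) (y - t)
          rwa [dist_sub_right, Real.dist_eq] at this
      _ = K * dist x y := by rw [integral_mul_const, hk1, one_mul]
  · intro x c ε h
    have hε : 0 ≤ ε := (abs_nonneg _).trans (h x (Metric.mem_ball_self hδ))
    exact dist_convolution_le hε ρ.support_normed_eq.subset hk0 hk1
      hf.continuous.aestronglyMeasurable h

theorem norm_gradient_le_of_lipschitzWith {f : E d → ℝ} {K : NNReal} (hf : LipschitzWith K f)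
    (x : E d) : ‖gradient f x‖ ≤ K := by
  rw [norm_gradient]
  exact norm_fderiv_le_of_lipschitz ℝ hf

/-! ### Unions of balls -/

/-- The trace on the closed unit cube of the union of the closed balls of radius `r`. -/
def ballTrace {n : ℕ} (x : Fin n → E d) (r : ℝ) : Set (E d) :=
  closure (unitCube d) ∩ ⋃ i, Metric.closedBall (x i) r

theorem volume_real_closedBall (x : E d) {r : ℝ} (hr : 0 ≤ r) :
    volume.real (Metric.closedBall x r) = unitBallVolume d * r ^ d := by
  rw [Measure.addHaar_real_closedBall _ _ hr, finrank_euclideanSpace_fin, mul_comm]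
  rfl

theorem volume_real_iUnion_closedBall_le {n : ℕ} (x : Fin n → E d) {r : ℝ} (hr : 0 ≤ r) :
    volume.real (⋃ i, Metric.closedBall (x i) r) ≤ n * (unitBallVolume d * r ^ d) := by
  refine (measureReal_iUnion_fintype_le _).trans (le_of_eq ?_)
  simp [volume_real_closedBall _ hr]

theorem volume_real_iUnion_diff_le {n : ℕ} (x : Fin n → E d) {r R : ℝ} (hr : 0 ≤ r) (hR : r ≤ R) :
    volume.real (⋃ i, Metric.closedBall (x i) R \ Metric.closedBall (x i) r) ≤
      n * (unitBallVolume d * (R ^ d - r ^ d)) := by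
  refine (measureReal_iUnion_fintype_le _).trans (le_of_eq ?_)
  have : ∀ i, volume.real (Metric.closedBall (x i) R \ Metric.closedBall (x i) r) =
      unitBallVolume d * (R ^ d - r ^ d) := by
    intro i
    rw [measureReal_sdiff (Metric.closedBall_subset_closedBall hR)
      Metric.isClosed_closedBall.measurableSet (isCompact_closedBall _ _).measure_lt_top.ne, volume_real_closedBall _ hr,
      volume_real_closedBall _ (hr.trans hR), mul_sub]
  simp [this]

open scoped NNReal in
/-- A smooth cut-off with slope at most `Q` which vanishes near the balls of radius `r` and is
constant outside those of radius `R`. -/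
theorem exists_cutoff {n : ℕ} (hn : 0 < n) (x : Fin n → E d) {r R : ℝ} (hR : r < R)
    (Q : ℝ≥0) {ε : ℝ} (hε : 0 < ε) (hε1 : ε < 1) :
    ∃ g : E d → ℝ, ContDiff ℝ ∞ g ∧ (∀ y, 0 ≤ g y) ∧ (∀ y, g y ≤ Q * ((1 - ε) * (R - r))) ∧
      (∃ T : Set (E d), IsClosed T ∧ Function.support g ⊆ T ∧
        ∀ i, Disjoint T (Metric.closedBall (x i) r)) ∧
      (∀ y ∉ ⋃ i, Metric.closedBall (x i) R, g y = Q * ((1 - ε) * (R - r))) ∧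
      (∀ y, ‖gradient g y‖ ≤ Q) ∧
      ∀ y ∉ ⋃ i, Metric.closedBall (x i) R \ Metric.closedBall (x i) r, gradient g y = 0 := by
  -- The ramp occupies `[r + 2δ, R - 2δ]`; mollification at scale `δ` leaves margins of width `δ` at
  -- both ends, where `g` is constant.
  set δ := ε * (R - r) / 4 with hδ
  have hRr : 0 < R - r := sub_pos.2 hR
  have hδ0 : 0 < δ := by positivity
  set H := (1 - ε) * (R - r) with hH
  have hH0 : 0 ≤ H := mul_nonneg (by linarith) hRr.le
  have hHδ : H = R - r - 4 * δ := by rw [hH, hδ]; ring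
  set X := range x with hX
  -- `Metric.infDist` to the empty set is 0 by convention, whence the assumption `0 < n`.
  have hXne : X.Nonempty := ⟨x ⟨0, hn⟩, mem_range_self _⟩
  set D : E d → ℝ := fun y => Metric.infDist y X with hD
  have hDL : LipschitzWith 1 D := Metric.lipschitz_infDist_pt X
  have hDd : ∀ y z, D z ≤ D y + dist z y := fun y z => Metric.infDist_le_infDist_add_dist
  set f : E d → ℝ := fun y => Q * max 0 (min (D y - (r + 2 * δ)) H) with hf
  have hfL : LipschitzWith Q f := by
    have h1 : LipschitzWith 1 fun y => max 0 (min (D y - (r + 2 * δ)) H) := by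
      refine LipschitzWith.const_max (LipschitzWith.min_const ?_ _) _
      refine LipschitzWith.of_dist_le_mul fun a b => ?_
      rw [dist_sub_right]
      exact hDL.dist_le_mul a b
    refine LipschitzWith.of_dist_le_mul fun a b => ?_
    have := h1.dist_le_mul a b
    rw [Real.dist_eq] at this
    rw [Real.dist_eq, hf]
    simp only
    rw [← mul_sub, abs_mul, NNReal.abs_eq]
    refine mul_le_mul_of_nonneg_left ?_ Q.2
    simpa using this
  obtain ⟨g, hg, hgL, hgc⟩ := exists_contDiff_lipschitzWith hfL hδ0
  have hQ0 : (0 : ℝ) ≤ Q := Q.2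
  have hbd : ∀ y, |g y - Q * H / 2| ≤ Q * H / 2 := fun y => hgc y _ _ fun z _ => by
    have h1 : 0 ≤ max 0 (min (D z - (r + 2 * δ)) H) := le_max_left _ _
    have h2 : max 0 (min (D z - (r + 2 * δ)) H) ≤ H := max_le hH0 (min_le_right _ _)
    have h3 := mul_nonneg hQ0 h1
    have h4 := mul_le_mul_of_nonneg_left h2 hQ0
    rw [abs_le]
    constructor <;> simp only [hf] <;> linarith
  have hzero : ∀ y, D y < r + δ → g y = 0 := fun y hy => by
    have := hgc y 0 0 fun z hz => by
      have hz' := hDd y z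
      rw [Metric.mem_ball] at hz
      have : max 0 (min (D z - (r + 2 * δ)) H) = 0 :=
        max_eq_left ((min_le_left _ _).trans (by linarith))
      simp [hf, this]
    simpa using this
  have hconst : ∀ y, R - δ < D y → g y = Q * H := fun y hy => by
    have := hgc y (Q * H) 0 fun z hz => by
      have hz' := hDd z y
      rw [Metric.mem_ball, dist_comm] at hz
      have : max 0 (min (D z - (r + 2 * δ)) H) = H := by
        rw [min_eq_right (by linarith), max_eq_right hH0]
      simp [hf, this]
    have := abs_nonpos_iff.1 this
    linarith
  have hgrad0 : ∀ y c, g =ᶠ[𝓝 y] (fun _ => c) → gradient g y = 0 := fun y c h => by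
    rw [h.gradient_eq]; simp [gradient]
  refine ⟨g, hg, fun y => ?_, fun y => ?_, ⟨{y | r + δ ≤ D y}, ?_, ?_, ?_⟩, fun y hy => ?_,
    norm_gradient_le_of_lipschitzWith hgL, fun y hy => ?_⟩
  · have := (abs_le.1 (hbd y)).1; linarith
  · have := (abs_le.1 (hbd y)).2; linarith
  · exact isClosed_le continuous_const hDL.continuous
  · intro y hy
    by_contra h
    exact hy (hzero y (not_le.1 h))
  · intro i
    rw [Set.disjoint_left]
    intro y hy hb
    have h1 : D y ≤ dist y (x i) := Metric.infDist_le_dist_of_mem (mem_range_self i)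
    rw [Metric.mem_closedBall] at hb
    have : r + δ ≤ D y := hy
    linarith
  · refine hconst y ?_
    obtain ⟨z, ⟨i, rfl⟩, hz⟩ := (finite_range x).isCompact.exists_infDist_eq_dist hXne y
    have h1 : R < dist y (x i) := by
      by_contra h
      exact hy (mem_iUnion.2 ⟨i, not_lt.1 h⟩)
    have : D y = dist y (x i) := hz
    linarith
  · rcases lt_or_ge (D y) (r + δ) with h | h
    · refine hgrad0 y 0 ?_
      filter_upwards [(isOpen_lt hDL.continuous continuous_const).mem_nhds h] with z hz
      exact hzero z hz
    · have h2 : R - δ < D y := by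
        by_contra h2
        obtain ⟨z, ⟨i, rfl⟩, hz⟩ := (finite_range x).isCompact.exists_infDist_eq_dist hXne y
        have h3 : D y = dist y (x i) := hz
        refine hy (mem_iUnion.2 ⟨i, ?_, ?_⟩)
        · rw [Metric.mem_closedBall]; linarith
        · rw [Metric.mem_closedBall]; linarith
      refine hgrad0 y (Q * H) ?_
      filter_upwards [(isOpen_lt continuous_const hDL.continuous).mem_nhds h2] with z hz
      exact hconst z hz

/-! ### Comparison of the compliances for two radii. -/

theorem norm_add_add_sq_le {F : Type*} [NormedAddCommGroup F] [InnerProductSpace ℝ F]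
    {a b : F} (hab : inner ℝ a b = 0) (c : F) {η : ℝ} (hη : 0 < η) :
    ‖a + (b + c)‖ ^ 2 ≤ (1 + η) * (‖a‖ ^ 2 + ‖b‖ ^ 2) + (1 + η⁻¹) * ‖c‖ ^ 2 := by
  have h1 : ‖a + b‖ ^ 2 = ‖a‖ ^ 2 + ‖b‖ ^ 2 := by rw [norm_add_sq_real, hab]; ring
  rw [← add_assoc, ← h1, norm_add_sq_real]
  have h2 := real_inner_le_norm (a + b) c
  have h3 : 2 * (‖a + b‖ * ‖c‖) ≤ η * ‖a + b‖ ^ 2 + η⁻¹ * ‖c‖ ^ 2 := by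
    have : 0 ≤ η⁻¹ * (η * ‖a + b‖ - ‖c‖) ^ 2 := by positivity
    have e : η⁻¹ * (η * ‖a + b‖ - ‖c‖) ^ 2 =
        η * ‖a + b‖ ^ 2 + η⁻¹ * ‖c‖ ^ 2 - 2 * (‖a + b‖ * ‖c‖) := by
      field_simp
      ring
    linarith
  linarith

open scoped NNReal in
/-- Comparison of the compliances for two radii with the same centres. -/
theorem cubeCompliance_ballTrace_ge (hd : 1 ≤ d) {n : ℕ} (hn : 0 < n) (x : Fin n → E d) {r R : ℝ}
    (hr : 0 ≤ r) (hR : r < R) (Q : ℝ≥0) {ε η : ℝ} (hε : 0 < ε) (hε1 : ε < 1) (hη : 0 < η)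
    {χ : E d → ℝ} (hχ : IsTestFunction (unitCube d) χ) (hχ0 : ∀ y, 0 ≤ χ y) (hχ1 : ∀ y, χ y ≤ 1) :
    (1 + η)⁻¹ * cubeCompliance (ballTrace x R)
      + 2 * (Q * ((1 - ε) * (R - r))) * ((∫ y, χ y) - n * (unitBallVolume d * R ^ d))
      - (1 + η) * Q ^ 2 * (n * (unitBallVolume d * (R ^ d - r ^ d)))
      - (1 + η⁻¹) * (Q * ((1 - ε) * (R - r))) ^ 2 * (∫ y, ‖gradient χ y‖ ^ 2)
      ≤ cubeCompliance (ballTrace x r) := by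
  obtain ⟨g, hg, hg0, hgH, ⟨T, hT, hgT, hTd⟩, hgout, hgQ, hggrad⟩ :=
    exists_cutoff hn x hR Q hε hε1
  set H : ℝ := Q * ((1 - ε) * (R - r)) with hH
  have hH0 : 0 ≤ H := (hg0 0).trans (hgH 0)
  set A := ⋃ i, Metric.closedBall (x i) R \ Metric.closedBall (x i) r with hA
  set B := ⋃ i, Metric.closedBall (x i) R with hB
  have hAm : MeasurableSet A := MeasurableSet.iUnion fun i =>
    Metric.isClosed_closedBall.measurableSet.diff Metric.isClosed_closedBall.measurableSet
  have hBm : MeasurableSet B := MeasurableSet.iUnion fun i =>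
    Metric.isClosed_closedBall.measurableSet
  have hBfin : volume B ≠ ⊤ := by
    have hc : IsCompact B := isCompact_iUnion fun i => isCompact_closedBall _ _
    exact hc.measure_lt_top.ne
  have hAB : A ⊆ B := iUnion_mono fun i => sdiff_subset
  have hAfin : volume A ≠ ⊤ := ((measure_mono hAB).trans_lt hBfin.lt_top).ne
  have hgd : Differentiable ℝ g := hg.differentiable (by simp)
  have hw : IsTestFunction (unitCube d \ ballTrace x r) fun y => g y * χ y := by
    refine ⟨hg.mul hχ.1, hχ.2.1.mul_left, fun y hy => ⟨?_, fun hS => ?_⟩⟩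
    · exact hχ.2.2 (closure_mono (Function.support_mul_subset_right g χ) hy)
    · have h1 : y ∈ T := by
        have : tsupport (fun y => g y * χ y) ⊆ T :=
          closure_minimal ((Function.support_mul_subset_left g χ).trans hgT) hT
        exact this hy
      obtain ⟨i, hi⟩ := mem_iUnion.1 hS.2
      exact Set.disjoint_left.1 (hTd i) h1 hi
  have hsub : unitCube d \ ballTrace x R ⊆ unitCube d \ ballTrace x r :=
    sdiff_subset_sdiff_right (inter_subset_inter_right _
      (iUnion_mono fun i => Metric.closedBall_subset_closedBall hR.le))
  have hint1 : H * ((∫ y, χ y) - n * (unitBallVolume d * R ^ d)) ≤ ∫ y, g y * χ y := by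
    have h1 : H * (∫ y, χ y) - H * volume.real B ≤ ∫ y, g y * χ y := by
      have hi : Integrable fun y => B.indicator (fun _ => H) y :=
        (integrable_indicator_iff hBm).2 (integrableOn_const hBfin)
      have e : H * (∫ y, χ y) - H * volume.real B = ∫ y, (H * χ y - B.indicator (fun _ => H) y) := by
        rw [integral_sub (hχ.integrable.const_mul _) hi, integral_const_mul,
          integral_indicator hBm, setIntegral_const, smul_eq_mul, mul_comm (volume.real B)]
      rw [e]
      refine integral_mono ((hχ.integrable.const_mul _).sub hi) hw.integrable fun y => ?_
      by_cases hy : y ∈ B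
      · simp only [indicator_of_mem hy]
        have h2 := mul_le_mul_of_nonneg_left (hχ1 y) hH0
        have h3 := mul_nonneg (hg0 y) (hχ0 y)
        linarith
      · simp only [indicator_of_notMem hy, hgout y hy, sub_zero]
        exact le_refl _
    have h2 := mul_le_mul_of_nonneg_left
      (volume_real_iUnion_closedBall_le x (hr.trans hR.le)) hH0
    linarith
  -- The competitor for radius `r` is `φ + g χ`. Separating the term `g ∇χ` by Young's inequality
  -- costs the factor `1 + η` on the other gradients.
  have key : ∀ φ : E d → ℝ, IsTestFunction (unitCube d \ ballTrace x R) φ →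
      (2 * ∫ y, φ y) - (1 + η) * (∫ y, ‖gradient φ y‖ ^ 2) +
        2 * H * ((∫ y, χ y) - n * (unitBallVolume d * R ^ d))
        - (1 + η) * Q ^ 2 * (n * (unitBallVolume d * (R ^ d - r ^ d)))
        - (1 + η⁻¹) * H ^ 2 * (∫ y, ‖gradient χ y‖ ^ 2)
        ≤ cubeCompliance (ballTrace x r) := by
    intro φ hφ
    have hv := (hφ.mono hsub).add hw
    refine le_trans ?_ (energy_le_cubeCompliance hd hv)
    unfold energy
    rw [integral_add hφ.integrable hw.integrable]
    have hpt : ∀ y, ‖gradient (fun y => φ y + g y * χ y) y‖ ^ 2 ≤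
        (1 + η) * (‖gradient φ y‖ ^ 2 + A.indicator (fun _ => (Q : ℝ) ^ 2) y) +
          (1 + η⁻¹) * (H ^ 2 * ‖gradient χ y‖ ^ 2) := by
      intro y
      rw [gradient_add_apply hφ.differentiable hw.differentiable,
        gradient_mul_apply hgd hχ.differentiable, add_comm (g y • gradient χ y)]
      -- `∇g` lives in the annuli, which lie in the `R`-balls, and there `∇φ` vanishes.
      have horth : inner ℝ (gradient φ y) (χ y • gradient g y) = 0 := by
        by_cases hy : y ∈ A
        · have : gradient φ y = 0 := by
            refine hφ.gradient_eq_zero fun hm => hm.2 ⟨subset_closure hm.1, hAB hy⟩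
          rw [this, inner_zero_left]
        · rw [hggrad y hy, smul_zero, inner_zero_right]
      refine (norm_add_add_sq_le horth _ hη).trans ?_
      have h1 : ‖χ y • gradient g y‖ ^ 2 ≤ A.indicator (fun _ => (Q : ℝ) ^ 2) y := by
        by_cases hy : y ∈ A
        · rw [indicator_of_mem hy, norm_smul, Real.norm_of_nonneg (hχ0 y)]
          refine pow_le_pow_left₀ (mul_nonneg (hχ0 y) (norm_nonneg _)) ?_ 2
          calc χ y * ‖gradient g y‖ ≤ 1 * Q :=
                mul_le_mul (hχ1 y) (hgQ y) (norm_nonneg _) zero_le_one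
            _ = Q := one_mul _
        · rw [indicator_of_notMem hy, hggrad y hy, smul_zero, norm_zero]
          simp
      have h2 : ‖g y • gradient χ y‖ ^ 2 ≤ H ^ 2 * ‖gradient χ y‖ ^ 2 := by
        rw [norm_smul, Real.norm_of_nonneg (hg0 y), mul_pow]
        exact mul_le_mul_of_nonneg_right (pow_le_pow_left₀ (hg0 y) (hgH y) 2) (sq_nonneg _)
      have hη1 : 0 < 1 + η := by linarith
      have hη2 : 0 < 1 + η⁻¹ := by positivity
      exact add_le_add (mul_le_mul_of_nonneg_left (by linarith) hη1.le)
        (mul_le_mul_of_nonneg_left h2 hη2.le)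
    have hiA : Integrable fun y => A.indicator (fun _ => (Q : ℝ) ^ 2) y :=
      (integrable_indicator_iff hAm).2 (integrableOn_const hAfin)
    have hi1 := hφ.integrable_norm_gradient_sq.add hiA
    have hi2 := hχ.integrable_norm_gradient_sq.const_mul (H ^ 2)
    have hle := integral_mono hv.integrable_norm_gradient_sq
      ((hi1.const_mul (1 + η)).add (hi2.const_mul (1 + η⁻¹))) hpt
    have he : ∫ y, ((1 + η) * (‖gradient φ y‖ ^ 2 + A.indicator (fun _ => (Q : ℝ) ^ 2) y) +
          (1 + η⁻¹) * (H ^ 2 * ‖gradient χ y‖ ^ 2)) =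
        (1 + η) * ((∫ y, ‖gradient φ y‖ ^ 2) + volume.real A * Q ^ 2) +
          (1 + η⁻¹) * (H ^ 2 * ∫ y, ‖gradient χ y‖ ^ 2) := by
      have e1 : ∫ y, (‖gradient φ y‖ ^ 2 + A.indicator (fun _ => (Q : ℝ) ^ 2) y) =
          (∫ y, ‖gradient φ y‖ ^ 2) + volume.real A * Q ^ 2 := by
        rw [integral_add hφ.integrable_norm_gradient_sq hiA, integral_indicator hAm,
          setIntegral_const, smul_eq_mul]
      rw [integral_add (f := fun y => (1 + η) *
          (‖gradient φ y‖ ^ 2 + A.indicator (fun _ => (Q : ℝ) ^ 2) y))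
          (hi1.const_mul (1 + η)) (hi2.const_mul (1 + η⁻¹)), integral_const_mul,
        integral_const_mul, integral_const_mul, e1]
    have hvA : volume.real A * (Q : ℝ) ^ 2 ≤
        n * (unitBallVolume d * (R ^ d - r ^ d)) * (Q : ℝ) ^ 2 :=
      mul_le_mul_of_nonneg_right (volume_real_iUnion_diff_le x hr hR.le) (sq_nonneg _)
    have hvA' := mul_le_mul_of_nonneg_left hvA (by linarith : (0 : ℝ) ≤ 1 + η)
    have hle' := hle.trans_eq he
    linarith
  have hη1 : 0 < 1 + η := by linarith
  have hF : cubeCompliance (ballTrace x R) ≤ (1 + η) * (cubeCompliance (ballTrace x r) -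
        2 * H * ((∫ y, χ y) - n * (unitBallVolume d * R ^ d))
        + (1 + η) * Q ^ 2 * (n * (unitBallVolume d * (R ^ d - r ^ d)))
        + (1 + η⁻¹) * H ^ 2 * (∫ y, ‖gradient χ y‖ ^ 2)) := by
    refine cubeCompliance_le hd fun ψ hψ => ?_
    -- Scaling by `(1 + η)⁻¹` compensates the factor `1 + η` in front of the Dirichlet term and
    -- restores a multiple of `energy ψ`.
    have h := key _ (hψ.const_mul (1 + η)⁻¹)
    have e1 : ∫ y, (1 + η)⁻¹ * ψ y = (1 + η)⁻¹ * ∫ y, ψ y := integral_const_mul _ _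
    have e2 : ∫ y, ‖gradient (fun y => (1 + η)⁻¹ * ψ y) y‖ ^ 2 =
        ((1 + η)⁻¹) ^ 2 * ∫ y, ‖gradient ψ y‖ ^ 2 := by
      rw [← integral_const_mul]
      refine integral_congr_ae (ae_of_all _ fun y => ?_)
      simp only
      rw [gradient_const_mul_apply hψ.differentiable, norm_smul, mul_pow, Real.norm_eq_abs, sq_abs]
    rw [e1, e2] at h
    have e3 : (2 * ((1 + η)⁻¹ * ∫ y, ψ y)) - (1 + η) * (((1 + η)⁻¹) ^ 2 *
        ∫ y, ‖gradient ψ y‖ ^ 2) = (1 + η)⁻¹ * energy ψ := by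
      unfold energy
      field_simp
    rw [e3] at h
    rw [← inv_mul_le_iff₀ hη1]
    linarith
  rw [← inv_mul_le_iff₀ hη1] at hF
  linarith

theorem exists_testFunction_integral_ge {ε : ℝ} (hε : 0 < ε) :
    ∃ χ : E d → ℝ, IsTestFunction (unitCube d) χ ∧ (∀ y, 0 ≤ χ y) ∧ (∀ y, χ y ≤ 1) ∧
      1 - ε ≤ ∫ y, χ y := by
  obtain ⟨K, hKI, hK, hKv⟩ := isOpen_unitCube.exists_lt_isCompact
    (show ENNReal.ofReal (1 - ε) < volume (unitCube d) by
      rw [volume_unitCube, ENNReal.ofReal_lt_one]; linarith)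
  obtain ⟨L, hL, hKL, hLI⟩ := exists_compact_between hK isOpen_unitCube hKI
  obtain ⟨f, hf0, hf1, hf⟩ := exists_contMDiffMap_zero_one_of_isClosed (n := ⊤)
    (modelWithCornersSelf ℝ (E d)) (isOpen_interior (s := L)).isClosed_compl hK.isClosed
    (disjoint_compl_left_iff_subset.2 hKL)
  have hsupp : tsupport (f : E d → ℝ) ⊆ L := by
    refine closure_minimal (fun y hy => ?_) hL.isClosed
    by_contra h
    exact hy (hf0 fun hm => h (interior_subset hm))
  have hχ : IsTestFunction (unitCube d) (f : E d → ℝ) :=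
    ⟨contMDiff_iff_contDiff.1 f.contMDiff, hL.of_isClosed_subset (isClosed_tsupport _) hsupp,
      hsupp.trans hLI⟩
  refine ⟨f, hχ, fun y => (hf y).1, fun y => (hf y).2, ?_⟩
  have h1 : 1 - ε ≤ volume.real K := by
    rw [measureReal_def]
    exact (ENNReal.ofReal_le_iff_le_toReal hK.measure_lt_top.ne).1 hKv.le
  refine h1.trans ?_
  have h2 : volume.real K = ∫ y, K.indicator (fun _ => (1 : ℝ)) y := by
    rw [integral_indicator hK.measurableSet, setIntegral_const, smul_eq_mul, mul_one]
  rw [h2]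
  refine integral_mono ((integrable_indicator_iff hK.measurableSet).2
    (integrableOn_const hK.measure_lt_top.ne)) hχ.integrable fun y => ?_
  by_cases hy : y ∈ K
  · simp only [indicator_of_mem hy]
    exact (hf1 hy).ge
  · simp only [indicator_of_notMem hy]
    exact (hf y).1

/-! ### Grids in the unit cube -/

/-- The points are the centres of the cells of a box subdivision. A surjection from `Fin n` onto the
cells uses up the surplus indices by repetition. -/
theorem exists_grid {n : ℕ} (N : Fin d → ℕ) (hN : ∀ j, 0 < N j) (hn : ∏ j, N j ≤ n) :
    ∃ x : Fin n → E d, (∀ i, x i ∈ unitCube d) ∧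
      ∀ y ∈ unitCube d, ∃ i, ∀ j, |y j - x i j| ≤ 1 / N j := by
  have : ∀ j, Nonempty (Fin (N j)) := fun j => ⟨⟨0, hN j⟩⟩
  obtain ⟨e⟩ : Nonempty ((∀ j, Fin (N j)) ↪ Fin n) := by
    rw [Function.Embedding.nonempty_iff_card_le]
    simpa using hn
  let s : Fin n → ∀ j, Fin (N j) := Function.invFun e
  have hs : Function.Surjective s := Function.invFun_surjective e.injective
  have hN' : ∀ j, (0 : ℝ) < N j := fun j => Nat.cast_pos.2 (hN j)
  refine ⟨fun i => WithLp.toLp 2 fun j => ((s i j : ℕ) + 1 / 2 : ℝ) / N j, fun i j => ?_,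
    fun y hy => ?_⟩
  · have h1 : ((s i j : ℕ) : ℝ) + 1 ≤ N j := by exact_mod_cast (s i j).2
    constructor
    · have := hN' j
      simp only
      positivity
    · simp only
      rw [div_lt_one (hN' j)]
      linarith
  · have hlt : ∀ j, ⌊y j * N j⌋₊ < N j := fun j => by
      rw [Nat.floor_lt (mul_nonneg (hy j).1.le (hN' j).le)]
      have := mul_lt_mul_of_pos_right (hy j).2 (hN' j)
      linarith
    obtain ⟨i, hi⟩ := hs fun j => ⟨⌊y j * N j⌋₊, hlt j⟩
    refine ⟨i, fun j => ?_⟩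
    simp only [hi]
    have h1 := Nat.floor_le (mul_nonneg (hy j).1.le (hN' j).le)
    have h2 := Nat.lt_floor_add_one (y j * N j)
    have e : y j - ((⌊y j * N j⌋₊ : ℝ) + 1 / 2) / N j =
        (y j * N j - (⌊y j * N j⌋₊ + 1 / 2)) / N j := by
      have := (hN' j).ne'
      field_simp
    rw [e, abs_div, abs_of_pos (hN' j)]
    refine div_le_div_of_nonneg_right ?_ (hN' j).le
    rw [abs_le]
    constructor <;> linarith

theorem norm_le_of_abs_le {v : E d} {a : ℝ} (ha : 0 ≤ a) (h : ∀ j, |v j| ≤ a) : ‖v‖ ≤ d * a := by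
  rw [EuclideanSpace.norm_eq]
  refine Real.sqrt_le_iff.2 ⟨by positivity, ?_⟩
  calc ∑ j, ‖v j‖ ^ 2 ≤ ∑ _j : Fin d, a ^ 2 :=
        Finset.sum_le_sum fun j _ => pow_le_pow_left₀ (norm_nonneg _) (h j) 2
    _ = d * a ^ 2 := by simp
    _ ≤ (d : ℝ) ^ 2 * a ^ 2 := by
        refine mul_le_mul_of_nonneg_right ?_ (sq_nonneg _)
        have : d ≤ d ^ 2 := Nat.le_self_pow two_ne_zero d
        exact_mod_cast this
    _ = (d * a) ^ 2 := by ring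

/-- A grid of balls meeting all segments of half-length of the order of `n^(-1/d)`. -/
theorem exists_ballTrace_compliance_le (hd : 1 ≤ d) {α : ℝ} (hα : 0 < α) :
    ∃ c : ℝ, ∀ (n : ℕ) (a : ℝ), a ^ d = n → c ≤ a → ∃ x : Fin n → E d,
      (∀ i, x i ∈ unitCube d) ∧ a ^ 2 * cubeCompliance (ballTrace x (α * a⁻¹)) ≤ 4 * c ^ 2 := by
  obtain ⟨k, rfl⟩ : ∃ k, d = k + 1 := ⟨d - 1, by omega⟩
  set D : ℝ := ((k + 1 : ℕ) : ℝ) with hD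
  have hD0 : 0 < D := by rw [hD]; positivity
  -- In the `k = d - 1` transverse directions the grid has `M` points with `d / M ≤ α / a`, fine
  -- enough for every line in direction 0 to meet balls. The remaining `M₁ = n / M^k` points go in
  -- direction 0; `A` is chosen so that `M ≤ A a`, which makes `1 / M₁` of order `1 / a`.
  set A : ℝ := D / α + 1 with hA
  have hA1 : 1 ≤ A := by
    have : 0 < D / α := by positivity
    linarith
  have hAk : 1 ≤ A ^ k := one_le_pow₀ hA1
  refine ⟨2 * A ^ k, fun n a han hca => ?_⟩
  have ha0 : 0 < a := by linarith
  have ha1 : 1 ≤ a := by linarith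
  set M := ⌈D * a / α⌉₊ with hM
  have hMle : D * a / α ≤ M := Nat.le_ceil _
  have hM0' : (0 : ℝ) < M := lt_of_lt_of_le (by positivity) hMle
  have hM0 : 0 < M := by exact_mod_cast hM0'
  have hMlt : (M : ℝ) ≤ A * a := by
    have := (Nat.ceil_lt_add_one (by positivity : 0 ≤ D * a / α)).le
    calc (M : ℝ) ≤ D * a / α + 1 := this
      _ ≤ D * a / α + a := by linarith
      _ = A * a := by rw [hA]; ring
  set M₁ := n / M ^ k with hM₁
  have hMk : 0 < M ^ k := pow_pos hM0 k
  have hlt : a < (M₁ + 1 : ℝ) * A ^ k := by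
    have h1 : n < M ^ k * (M₁ + 1) := Nat.lt_mul_div_succ n hMk
    have h2 : (n : ℝ) < (M : ℝ) ^ k * (M₁ + 1) := by exact_mod_cast h1
    have h3 : (M : ℝ) ^ k ≤ A ^ k * a ^ k := by
      rw [← mul_pow]; exact pow_le_pow_left₀ hM0'.le hMlt k
    have h4 : a ^ k * a < a ^ k * ((M₁ + 1) * A ^ k) := by
      rw [← pow_succ, han]
      refine h2.trans_le ?_
      have := mul_le_mul_of_nonneg_right h3 (by positivity : (0 : ℝ) ≤ M₁ + 1)
      linarith
    exact lt_of_mul_lt_mul_left h4 (by positivity)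
  have hM₁2 : 1 < (M₁ : ℝ) := by
    have h5 : 2 * A ^ k < (M₁ + 1 : ℝ) * A ^ k := hca.trans_lt hlt
    have := lt_of_mul_lt_mul_right h5 (by positivity)
    linarith
  have hM₁0 : 0 < M₁ := by
    have : (0 : ℝ) < M₁ := by linarith
    exact_mod_cast this
  have hL : 1 / (M₁ : ℝ) ≤ 2 * A ^ k * a⁻¹ := by
    rw [div_le_iff₀ (by linarith), mul_assoc, mul_comm a⁻¹, ← mul_assoc, ← div_eq_mul_inv,
      le_div_iff₀ ha0]
    have := mul_le_mul_of_nonneg_right (by linarith : (M₁ + 1 : ℝ) ≤ 2 * M₁)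
      (by linarith : 0 ≤ A ^ k)
    linarith
  let N : Fin (k + 1) → ℕ := Fin.cons M₁ fun _ => M
  have hN0 : N 0 = M₁ := rfl
  have hNs : ∀ j : Fin k, N j.succ = M := fun j => rfl
  obtain ⟨x, hx, hgrid⟩ := exists_grid (d := k + 1) (n := n) N
    (fun j => by refine Fin.cases ?_ (fun j => ?_) j <;> simp [hN0, hNs, hM0, hM₁0])
    (by rw [Fin.prod_univ_succ]; simp only [hN0, hNs]; simp [hM₁, Nat.div_mul_le_self])
  refine ⟨x, hx, ?_⟩
  have hcomp : cubeCompliance (ballTrace x (α * a⁻¹)) ≤ 4 * (1 / (M₁ : ℝ)) ^ 2 := by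
    refine cubeCompliance_le_of_shift 0 (by positivity) fun y hy => ?_
    obtain ⟨i, hi⟩ := hgrid y hy
    -- The shift aligns the coordinate 0 with that of the centre; only the transverse offset, at
    -- most `d / M`, is left.
    refine ⟨x i 0 - y 0, ?_, subset_closure ?_, mem_iUnion.2 ⟨i, ?_⟩⟩
    · rw [abs_sub_comm]; exact hi 0
    · intro j
      refine Fin.cases ?_ (fun j => ?_) j
      · simpa using hx i 0
      · simpa using hy j.succ
    · rw [Metric.mem_closedBall, dist_eq_norm]
      have h1 : ∀ j, |(y + (x i 0 - y 0) • EuclideanSpace.single 0 (1 : ℝ) - x i : E (k + 1)) j| ≤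
          1 / (M : ℝ) := by
        intro j
        refine Fin.cases ?_ (fun j => ?_) j
        · simp
        · simpa [hNs] using hi j.succ
      refine (norm_le_of_abs_le (by positivity) h1).trans ?_
      rw [← hD, mul_one_div, div_le_iff₀ hM0']
      have := mul_le_mul_of_nonneg_left hMle (by positivity : 0 ≤ α * a⁻¹)
      have e : α * a⁻¹ * (D * a / α) = D := by field_simp
      linarith
  calc a ^ 2 * cubeCompliance (ballTrace x (α * a⁻¹)) ≤ a ^ 2 * (4 * (1 / (M₁ : ℝ)) ^ 2) :=
        mul_le_mul_of_nonneg_left hcomp (sq_nonneg _)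
    _ ≤ a ^ 2 * (4 * (2 * A ^ k * a⁻¹) ^ 2) := by gcongr
    _ = 4 * (2 * A ^ k) ^ 2 := by field_simp

/-- For a large radius the balls of a grid cover the unit cube. -/
theorem exists_ballTrace_compliance_eq_zero (hd : 1 ≤ d) (n : ℕ) {a : ℝ} (ha : a ^ d = n)
    (ha1 : 1 ≤ a) : ∃ x : Fin n → E d,
      (∀ i, x i ∈ unitCube d) ∧ cubeCompliance (ballTrace x (2 * d * a⁻¹)) = 0 := by
  set m := ⌊a⌋₊ with hm
  have hm0 : 0 < m := Nat.floor_pos.2 ha1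
  have hm0' : (1 : ℝ) ≤ m := by exact_mod_cast hm0
  have hma : (m : ℝ) ≤ a := Nat.floor_le (by linarith)
  have ham : a < m + 1 := Nat.lt_floor_add_one a
  obtain ⟨x, hx, hgrid⟩ := exists_grid (d := d) (n := n) (fun _ => m) (fun _ => hm0) (by
    have : (m : ℝ) ^ d ≤ n := by rw [← ha]; exact pow_le_pow_left₀ (by linarith) hma d
    simp only [Finset.prod_const, Finset.card_univ, Fintype.card_fin]
    exact_mod_cast this)
  refine ⟨x, hx, cubeCompliance_eq_zero_of_subset hd fun y hy => ⟨subset_closure hy, ?_⟩⟩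
  obtain ⟨i, hi⟩ := hgrid y hy
  refine mem_iUnion.2 ⟨i, ?_⟩
  rw [Metric.mem_closedBall, dist_eq_norm]
  refine (norm_le_of_abs_le (v := y - x i) (by positivity) hi).trans ?_
  rw [mul_comm (2 : ℝ), mul_assoc]
  refine mul_le_mul_of_nonneg_left ?_ (Nat.cast_nonneg d)
  rw [← div_eq_mul_inv, div_le_div_iff₀ (by linarith) (by linarith)]
  linarith

/-! ### The function `θ` -/

/-- The number `n^(1/d)`. -/
noncomputable def root (d n : ℕ) : ℝ := (n : ℝ) ^ (1 / (d : ℝ))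

theorem root_pow (hd : 1 ≤ d) (n : ℕ) : root d n ^ d = n := by
  rw [root, one_div]
  exact Real.rpow_inv_natCast_pow (Nat.cast_nonneg n) (by omega)

theorem root_nonneg (n : ℕ) : 0 ≤ root d n := Real.rpow_nonneg (Nat.cast_nonneg n) _

theorem rpow_neg_eq_inv_root (n : ℕ) : (n : ℝ) ^ (-(1 / (d : ℝ))) = (root d n)⁻¹ :=
  Real.rpow_neg (Nat.cast_nonneg n) _

theorem rpow_two_div_eq_root_sq (n : ℕ) : (n : ℝ) ^ (2 / (d : ℝ)) = root d n ^ 2 := by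
  rw [root, ← Real.rpow_mul_natCast (Nat.cast_nonneg n)]
  congr 1
  push_cast
  ring

theorem tendsto_root (hd : 1 ≤ d) : Tendsto (root d) atTop atTop := by
  have h : 0 < 1 / (d : ℝ) := by
    have : (0 : ℝ) < d := by exact_mod_cast hd
    positivity
  exact (tendsto_rpow_atTop h).comp tendsto_natCast_atTop_atTop

theorem root_pos {n : ℕ} (hn : 0 < n) : 0 < root d n := Real.rpow_pos_of_pos (Nat.cast_pos.2 hn) _

theorem mem_admissible_iff {α : ℝ} {n : ℕ} {S : Set (E d)} :
    S ∈ admissible α n (unitCube d) ↔ ∃ x : Fin n → E d,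
      (∀ i, x i ∈ Metric.thickening (α * (root d n)⁻¹) (unitCube d)) ∧
      S = ballTrace x (α * (root d n)⁻¹) := by
  unfold admissible ballTrace
  rw [mem_ofPred_eq, rpow_neg_eq_inv_root]

theorem nonempty_unitCube : (unitCube d).Nonempty :=
  ⟨WithLp.toLp 2 fun _ => 1 / 2, fun i => by norm_num⟩

theorem ballTrace_mem_admissible {α : ℝ} (hα : 0 < α) {n : ℕ} {x : Fin n → E d}
    (hx : ∀ i, x i ∈ unitCube d) :
    ballTrace x (α * (root d n)⁻¹) ∈ admissible α n (unitCube d) := by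
  refine mem_admissible_iff.2 ⟨x, fun i => ?_, rfl⟩
  have hn : 0 < n := i.pos
  exact Metric.self_subset_thickening (mul_pos hα (inv_pos.2 (root_pos hn))) _ (hx i)

/-- The lower limit sees only large `n`; for the other `n` all centres are put at one point of the
cube, to keep the whole sequence admissible. -/
theorem thetaExt_le {α : ℝ} (hα : 0 < α) {c : ℝ}
    (h : ∀ᶠ n : ℕ in atTop, ∃ x : Fin n → E d, (∀ i, x i ∈ unitCube d) ∧
      root d n ^ 2 * cubeCompliance (ballTrace x (α * (root d n)⁻¹)) ≤ c) :
    thetaExt d α ≤ ENNReal.ofReal c := by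
  have h' : ∀ n : ℕ, ∃ x : Fin n → E d, (∀ i, x i ∈ unitCube d) ∧
      ((∃ x : Fin n → E d, (∀ i, x i ∈ unitCube d) ∧
        root d n ^ 2 * cubeCompliance (ballTrace x (α * (root d n)⁻¹)) ≤ c) →
        root d n ^ 2 * cubeCompliance (ballTrace x (α * (root d n)⁻¹)) ≤ c) := by
    intro n
    by_cases hn : ∃ x : Fin n → E d, (∀ i, x i ∈ unitCube d) ∧
        root d n ^ 2 * cubeCompliance (ballTrace x (α * (root d n)⁻¹)) ≤ c
    · obtain ⟨x, hx, hc⟩ := hn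
      exact ⟨x, hx, fun _ => hc⟩
    · obtain ⟨p, hp⟩ := nonempty_unitCube (d := d)
      exact ⟨fun _ => p, fun _ => hp, fun h => absurd h hn⟩
  choose x hx hxc using h'
  refine (iInf₂_le (fun n => ballTrace (x n) (α * (root d n)⁻¹))
    fun n => ballTrace_mem_admissible hα (hx n)).trans ?_
  have hev : ∀ᶠ n : ℕ in atTop, ENNReal.ofReal ((n : ℝ) ^ (2 / (d : ℝ)) *
      compliance (ballTrace (x n) (α * (root d n)⁻¹)) (fun _ => 1) (unitCube d)) ≤
      ENNReal.ofReal c := by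
    filter_upwards [h] with n hn
    rw [rpow_two_div_eq_root_sq]
    exact ENNReal.ofReal_le_ofReal (hxc n hn)
  exact (liminf_le_liminf hev).trans (liminf_const _).le

theorem thetaExt_lt_top (hd : 1 ≤ d) {α : ℝ} (hα : 0 < α) : thetaExt d α < ⊤ := by
  obtain ⟨c, hc⟩ := exists_ballTrace_compliance_le hd hα
  refine (thetaExt_le hα (c := 4 * c ^ 2) ?_).trans_lt ENNReal.ofReal_lt_top
  filter_upwards [(tendsto_root hd).eventually_ge_atTop c] with n hn
  exact hc n (root d n) (root_pow hd n) hn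

theorem thetaExt_two_mul_eq_zero (hd : 1 ≤ d) : thetaExt d (2 * d) = 0 := by
  have hd0 : (0 : ℝ) < d := by exact_mod_cast hd
  refine le_antisymm ((thetaExt_le (by positivity) (c := 0) ?_).trans (by simp)) bot_le
  filter_upwards [(tendsto_root hd).eventually_ge_atTop 1] with n hn
  obtain ⟨x, hx, h0⟩ := exists_ballTrace_compliance_eq_zero hd n (root_pow hd n) hn
  exact ⟨x, hx, by rw [h0, mul_zero]⟩

theorem ofReal_theta (hd : 1 ≤ d) {α : ℝ} (hα : 0 < α) :
    ENNReal.ofReal (theta d α) = thetaExt d α :=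
  ENNReal.ofReal_toReal (thetaExt_lt_top hd hα).ne

theorem theta_nonneg (α : ℝ) : 0 ≤ theta d α := ENNReal.toReal_nonneg

theorem eventually_theta_sub_lt (hd : 1 ≤ d) {β : ℝ} (hβ : 0 < β) {S : ℕ → Set (E d)}
    (hS : ∀ n, S n ∈ admissible β n (unitCube d)) {ε : ℝ} (hε : 0 < ε) :
    ∀ᶠ n : ℕ in atTop, theta d β - ε ≤ root d n ^ 2 * cubeCompliance (S n) := by
  rcases lt_or_ge (theta d β - ε) 0 with h | h
  · exact Eventually.of_forall fun n =>
      h.le.trans (mul_nonneg (sq_nonneg _) (cubeCompliance_nonneg hd _))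
  · have h1 : ENNReal.ofReal (theta d β - ε) < thetaExt d β := by
      rw [← ofReal_theta hd hβ]
      exact (ENNReal.ofReal_lt_ofReal_iff (by linarith)).2 (by linarith)
    have h2 := h1.trans_le (iInf₂_le S hS)
    filter_upwards [eventually_lt_of_lt_liminf h2] with n hn
    rw [rpow_two_div_eq_root_sq] at hn
    by_contra hc
    exact absurd (ENNReal.ofReal_le_ofReal (not_le.1 hc).le) (not_le.2 hn)

theorem unitBallVolume_pos : 0 < unitBallVolume d := by
  unfold unitBallVolume
  rw [measureReal_def]
  exact ENNReal.toReal_pos (Metric.measure_ball_pos _ _ one_pos).ne' measure_ball_lt_top.ne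

/-- Rescaled comparison of radii. One `ε` serves as slack in the lower limit, in the height of the
cut-off, in Young's inequality, in the mass of `χ` and in the boundary error. -/
theorem theta_add_le_of_eps (hd : 1 ≤ d) {α β : ℝ} (hα : 0 < α) (hαβ : α < β) (q : NNReal) {ε : ℝ}
    (hε : 0 < ε) (hε1 : ε < 1) :
    (1 + ε)⁻¹ * (theta d β - ε) + 2 * q * (1 - ε) * (β - α) * (1 - ε - unitBallVolume d * β ^ d)
      - (1 + ε) * q ^ 2 * (unitBallVolume d * (β ^ d - α ^ d)) - ε ≤ theta d α := by
  have hβ : 0 < β := hα.trans hαβ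
  obtain ⟨χ, hχ, hχ0, hχ1, hχi⟩ := exists_testFunction_integral_ge (d := d) hε
  set C := ∫ y, ‖gradient χ y‖ ^ 2 with hC
  set P := (1 + ε)⁻¹ * (theta d β - ε) +
    2 * q * (1 - ε) * (β - α) * (1 - ε - unitBallVolume d * β ^ d)
      - (1 + ε) * q ^ 2 * (unitBallVolume d * (β ^ d - α ^ d)) - ε with hP
  have hmain : ENNReal.ofReal P ≤ thetaExt d α := by
    refine le_iInf₂ fun S hS => ?_
    choose x hx hSx using fun n => mem_admissible_iff.1 (hS n)
    have hS' : ∀ n, ballTrace (x n) (β * (root d n)⁻¹) ∈ admissible β n (unitCube d) := fun n =>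
      mem_admissible_iff.2 ⟨x n, fun i => Metric.thickening_mono
        (mul_le_mul_of_nonneg_right hαβ.le (inv_nonneg.2 (root_nonneg n))) _ (hx n i), rfl⟩
    -- `χ` is fixed before `n`, and the height of the added function is of order `n^(-2/d)`; so its
    -- squared contribution, even multiplied by `n^(2/d)`, tends to 0.
    have herr : Tendsto (fun n : ℕ => (1 + ε⁻¹) * (q * ((1 - ε) * (β - α))) ^ 2 * C *
        ((root d n)⁻¹) ^ 2) atTop (𝓝 0) := by
      have := ((tendsto_inv_atTop_zero.comp (tendsto_root hd)).pow 2).const_mul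
        ((1 + ε⁻¹) * (q * ((1 - ε) * (β - α))) ^ 2 * C)
      simpa using this
    refine le_liminf_of_le (by isBoundedDefault) ?_
    filter_upwards [eventually_theta_sub_lt hd hβ hS' hε, herr.eventually_le_const hε,
      eventually_gt_atTop 0] with n h1 h2 hn
    refine ENNReal.ofReal_le_ofReal ?_
    rw [rpow_two_div_eq_root_sq, hSx n]
    set a := root d n with ha
    have ha0 : 0 < a := root_pos hn
    have han : a ^ d = n := root_pow hd n
    have hcmp := cubeCompliance_ballTrace_ge hd hn (x n) (r := α * a⁻¹) (R := β * a⁻¹)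
      (by positivity) (mul_lt_mul_of_pos_right hαβ (inv_pos.2 ha0))
      (q * (a⁻¹).toNNReal) hε hε1 hε hχ hχ0 hχ1
    have hQ : ((q * (a⁻¹).toNNReal : NNReal) : ℝ) = q * a⁻¹ := by
      rw [NNReal.coe_mul, Real.coe_toNNReal _ (inv_nonneg.2 ha0.le)]
    rw [hQ] at hcmp
    have hsc := mul_le_mul_of_nonneg_left hcmp (sq_nonneg a)
    refine le_trans ?_ hsc
    have hni : (n : ℝ) * (a⁻¹) ^ d = 1 := by
      rw [← han, inv_pow, mul_inv_cancel₀ (pow_pos ha0 d).ne']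
    have e1 : (n : ℝ) * (unitBallVolume d * (β * a⁻¹) ^ d) = unitBallVolume d * β ^ d := by
      rw [mul_pow]
      linear_combination unitBallVolume d * β ^ d * hni
    have e2 : (n : ℝ) * (unitBallVolume d * ((β * a⁻¹) ^ d - (α * a⁻¹) ^ d)) =
        unitBallVolume d * (β ^ d - α ^ d) := by
      rw [mul_pow, mul_pow]
      linear_combination unitBallVolume d * (β ^ d - α ^ d) * hni
    have hai : a * a⁻¹ = 1 := mul_inv_cancel₀ ha0.ne'
    have e3 : (q : ℝ) * a⁻¹ * ((1 - ε) * (β * a⁻¹ - α * a⁻¹)) =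
        q * ((1 - ε) * (β - α)) * (a⁻¹) ^ 2 := by ring
    rw [e1, e2, e3, ← hC]
    have e4 : a ^ 2 * ((1 + ε)⁻¹ * cubeCompliance (ballTrace (x n) (β * a⁻¹)) +
          2 * (q * ((1 - ε) * (β - α)) * a⁻¹ ^ 2) * ((∫ y, χ y) - unitBallVolume d * β ^ d) -
          (1 + ε) * (q * a⁻¹) ^ 2 * (unitBallVolume d * (β ^ d - α ^ d)) -
          (1 + ε⁻¹) * (q * ((1 - ε) * (β - α)) * a⁻¹ ^ 2) ^ 2 * C) =
        (1 + ε)⁻¹ * (a ^ 2 * cubeCompliance (ballTrace (x n) (β * a⁻¹))) +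
          2 * q * (1 - ε) * (β - α) * ((∫ y, χ y) - unitBallVolume d * β ^ d) -
          (1 + ε) * q ^ 2 * (unitBallVolume d * (β ^ d - α ^ d)) -
          (1 + ε⁻¹) * (q * ((1 - ε) * (β - α))) ^ 2 * C * a⁻¹ ^ 2 := by
      field_simp
    rw [e4, hP]
    have h3 := mul_le_mul_of_nonneg_left h1 (by positivity : 0 ≤ (1 + ε)⁻¹)
    have hnn : 0 ≤ 2 * (q : ℝ) * (1 - ε) * (β - α) :=
      mul_nonneg (mul_nonneg (by positivity) (by linarith)) (by linarith)
    have h4 := mul_le_mul_of_nonneg_left hχi hnn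
    linarith
  rw [← ofReal_theta hd hα] at hmain
  exact (ENNReal.ofReal_le_ofReal_iff (theta_nonneg α)).1 hmain

/-- The basic inequality between the values of `θ` at two radii. -/
theorem theta_add_le (hd : 1 ≤ d) {α β : ℝ} (hα : 0 < α) (hαβ : α < β) {q : ℝ} (hq : 0 ≤ q) :
    theta d β + 2 * q * (β - α) * (1 - unitBallVolume d * β ^ d)
      - q ^ 2 * (unitBallVolume d * (β ^ d - α ^ d)) ≤ theta d α := by
  lift q to NNReal using hq
  have hcont : ContinuousAt (fun ε : ℝ => (1 + ε)⁻¹ * (theta d β - ε) +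
      2 * q * (1 - ε) * (β - α) * (1 - ε - unitBallVolume d * β ^ d)
      - (1 + ε) * q ^ 2 * (unitBallVolume d * (β ^ d - α ^ d)) - ε) 0 := by
    have : ContinuousAt (fun ε : ℝ => (1 + ε)⁻¹) 0 :=
      ContinuousAt.inv₀ (by fun_prop) (by norm_num)
    fun_prop
  have hlim := hcont.tendsto.mono_left (nhdsWithin_le_nhds (s := Ioi 0))
  have := le_of_tendsto hlim (b := theta d α) (by
    filter_upwards [Ioo_mem_nhdsGT (zero_lt_one' ℝ)] with ε hε
    exact theta_add_le_of_eps hd hα hαβ q hε.1 hε.2)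
  simpa using this

/-! ### Consequences of the basic inequality: monotonicity, positivity, derivative. -/

theorem antitoneOn_theta (hd : 1 ≤ d) : AntitoneOn (theta d) (Ioi 0) := by
  intro α hα β _ hαβ
  rcases hαβ.eq_or_lt with rfl | h
  · exact le_rfl
  · simpa using theta_add_le hd hα h le_rfl

theorem ae_differentiableAt_theta (hd : 1 ≤ d) :
    ∀ᵐ α : ℝ, α ∈ Ioi 0 → DifferentiableAt ℝ (theta d) α := by
  have h : MonotoneOn (fun α => -theta d α) (Ioi 0) := (antitoneOn_theta hd).neg
  filter_upwards [h.ae_differentiableWithinAt_of_mem] with α hα hm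
  simpa using ((hα hm).differentiableAt (isOpen_Ioi.mem_nhds hm)).neg

theorem theta_pos_of_lt (hd : 1 ≤ d) {α β : ℝ} (hα : 0 < α) (hαβ : α < β)
    (hβ : unitBallVolume d * β ^ d < 1) : 0 < theta d α := by
  set A := (β - α) * (1 - unitBallVolume d * β ^ d) with hA
  set B := unitBallVolume d * (β ^ d - α ^ d) with hB
  have hA0 : 0 < A := mul_pos (by linarith) (by linarith)
  have hB0 : 0 < B :=
    mul_pos unitBallVolume_pos (sub_pos.2 (pow_lt_pow_left₀ hαβ hα.le (by omega)))
  -- `q = A / B` maximises `2 q A - q² B`, with value `A² / B`.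
  have h := theta_add_le hd hα hαβ (q := A / B) (by positivity)
  have e : theta d β + 2 * (A / B) * (β - α) * (1 - unitBallVolume d * β ^ d) -
      (A / B) ^ 2 * B = theta d β + A ^ 2 / B := by
    have : 2 * (A / B) * (β - α) * (1 - unitBallVolume d * β ^ d) = 2 * (A / B) * A := by
      rw [hA]; ring
    rw [this]
    field_simp
    ring
  rw [e] at h
  have : 0 < A ^ 2 / B := by positivity
  linarith [theta_nonneg (d := d) β]

theorem t₁_pos (hd : 1 ≤ d) : 0 < t₁ d := by
  have hd0 : (0 : ℝ) < d := by exact_mod_cast hd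
  have hω : 0 < unitBallVolume d := unitBallVolume_pos
  obtain ⟨β, hβ0, hβ⟩ : ∃ β : ℝ, 0 < β ∧ unitBallVolume d * β ^ d < 1 := by
    have hc : Tendsto (fun β : ℝ => unitBallVolume d * β ^ d) (𝓝[>] 0) (𝓝 0) := by
      have : Continuous fun β : ℝ => unitBallVolume d * β ^ d := by fun_prop
      have h := (this.tendsto 0).mono_left (nhdsWithin_le_nhds (s := Ioi 0))
      simpa [zero_pow (by omega : d ≠ 0)] using h
    obtain ⟨β, h1, h2⟩ := ((hc.eventually_lt_const one_pos).and self_mem_nhdsWithin).exists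
    exact ⟨β, h2, h1⟩
  -- The real infimum of an empty set is 0, so the existence of a zero of `θ` is really needed.
  refine hβ0.trans_le (le_csInf ⟨2 * d, by positivity, thetaExt_two_mul_eq_zero hd⟩ ?_)
  rintro t ⟨ht, h0⟩
  by_contra hlt
  have := theta_pos_of_lt hd ht (not_le.1 hlt) hβ
  simp [theta, h0] at this

theorem neg_deriv_theta_ge (hd : 1 ≤ d) {α : ℝ} (hα : 0 < α)
    (hdiff : DifferentiableAt ℝ (theta d) α) :
    α ^ (1 - (d : ℝ)) / (d * unitBallVolume d) - 2 * (α / d) ≤ -deriv (theta d) α := by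
  set v := unitBallVolume d with hV
  have hv0 : 0 < v := unitBallVolume_pos
  have hd0 : (0 : ℝ) < d := by exact_mod_cast hd
  -- The derivative of the basic inequality at `β = α` reads `θ' + 2 q (1 - ω α^d) - q² ω d α^(d-1)
  -- ≤ 0`. The optimal slope would carry a further factor `1 - ω α^d`; without it the quadratic term
  -- is exactly `q`, and the bound becomes `q - 2α/d`.
  set q : ℝ := α ^ (1 - (d : ℝ)) / (d * v) with hq
  have hq0 : 0 ≤ q := by positivity
  let G : ℝ → ℝ := fun β => theta d β + 2 * q * (β - α) * (1 - v * β ^ d) -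
    q ^ 2 * (v * (β ^ d - α ^ d))
  have hpow : HasDerivAt (fun β : ℝ => β ^ d) (d * α ^ (d - 1)) α := hasDerivAt_pow d α
  have hG : HasDerivAt G (deriv (theta d) α + (2 * q * (1 - v * α ^ d)) -
      q ^ 2 * (v * (d * α ^ (d - 1)))) α := by
    have h1 : HasDerivAt (fun β : ℝ => 2 * q * (β - α) * (1 - v * β ^ d))
        (2 * q * (1 - v * α ^ d)) α := by
      have := (((hasDerivAt_id α).sub_const α).const_mul (2 * q)).mul
        ((hpow.const_mul v).const_sub 1)
      refine this.congr_deriv ?_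
      simp
    exact (hdiff.hasDerivAt.add h1).sub (((hpow.sub_const _).const_mul v).const_mul (q ^ 2))
  have hslope : Tendsto (slope G α) (𝓝[>] α) (𝓝 (deriv (theta d) α + (2 * q * (1 - v * α ^ d)) -
      q ^ 2 * (v * (d * α ^ (d - 1))))) :=
    (hasDerivAt_iff_tendsto_slope.1 hG).mono_left (nhdsWithin_mono _ fun y hy => ne_of_gt hy)
  -- `G α = θ(α)` and `G β ≤ θ(α)` for `β > α`, so the right derivative of `G` at `α` is at most 0.
  have hle := le_of_tendsto hslope (b := 0) (by
    filter_upwards [self_mem_nhdsWithin] with β hβ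
    have h1 : G β ≤ theta d α := theta_add_le hd hα hβ hq0
    have h2 : G α = theta d α := by simp [G]
    rw [slope_def_field, h2]
    exact div_nonpos_of_nonpos_of_nonneg (by linarith) (sub_nonneg.2 (le_of_lt hβ)))
  have hqp : q * (v * (d * α ^ (d - 1))) = 1 := by
    have h1 : α ^ (1 - (d : ℝ)) * α ^ (d - 1) = 1 := by
      rw [← Real.rpow_natCast α (d - 1), ← Real.rpow_add hα, Nat.cast_sub hd]
      simp
    rw [hq]
    field_simp
    linarith
  have hqa : q * v * α ^ d = α / d := by
    have h2 : α ^ d = α ^ (d - 1) * α := by rw [← pow_succ, Nat.sub_add_cancel hd]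
    rw [h2, eq_div_iff hd0.ne']
    linear_combination α * hqp
  have e1 : q ^ 2 * (v * (d * α ^ (d - 1))) = q := by
    linear_combination q * hqp
  have e2 : 2 * q * (1 - v * α ^ d) = 2 * q - 2 * (α / d) := by
    linear_combination (-2) * hqa
  rw [e1, e2] at hle
  linarith

/-- Integrated form of the lower bound for the derivative of `θ`, in terms of a primitive `Ψ`. -/
theorem theta_sub_ge (hd : 1 ≤ d) {Ψ : ℝ → ℝ}
    (hΨ : ∀ s, 0 < s → HasDerivAt Ψ
      (-(s ^ (1 - (d : ℝ)) / (d * unitBallVolume d) - 2 * (s / d))) s)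
    {α β : ℝ} (hα : 0 < α) (hαβ : α ≤ β) : Ψ α - Ψ β ≤ theta d α := by
  set ψ : ℝ → ℝ := fun s => s ^ (1 - (d : ℝ)) / (d * unitBallVolume d) - 2 * (s / d) with hψ
  have hpos : ∀ s ∈ uIcc α β, 0 < s := fun s hs => by
    rw [uIcc_of_le hαβ] at hs; exact hα.trans_le hs.1
  have hψc : ContinuousOn ψ (uIcc α β) := by
    refine ContinuousOn.sub (ContinuousOn.div_const (fun s hs => ?_) _) (by fun_prop)
    exact (Real.continuousAt_rpow_const s _ (Or.inl (hpos s hs).ne')).continuousWithinAt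
  have hψi : IntervalIntegrable ψ volume α β := hψc.intervalIntegrable
  have hint : ∫ s in α..β, ψ s = Ψ α - Ψ β := by
    have := intervalIntegral.integral_eq_sub_of_hasDerivAt (f := fun s => -Ψ s) (f' := ψ)
      (a := α) (b := β) (fun s hs => (hΨ s (hpos s hs)).neg.congr_deriv (neg_neg _)) hψi
    rw [this]; ring
  have hm : MonotoneOn (fun s => -theta d s) (uIcc α β) :=
    (antitoneOn_theta hd).neg.mono fun s hs => hpos s hs
  -- Absolute continuity of `θ` is not at hand, but for a monotone function the integral of the
  -- derivative is at most the increment, which is the direction wanted.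
  have h1 := hm.intervalIntegral_deriv_mem_uIcc
  have hm2 : -theta d α ≤ -theta d β := hm (by simp) (by simp) hαβ
  rw [uIcc_of_le (by linarith)] at h1
  have h2 : ∫ s in α..β, ψ s ≤ ∫ s in α..β, deriv (fun s => -theta d s) s := by
    refine intervalIntegral.integral_mono_ae_restrict hαβ hψi hm.intervalIntegrable_deriv ?_
    rw [EventuallyLE, ae_restrict_iff' measurableSet_Icc]
    filter_upwards [ae_differentiableAt_theta hd] with s hs hm
    have hs0 : 0 < s := hα.trans_le hm.1
    rw [deriv.fun_neg]
    exact neg_deriv_theta_ge hd hs0 (hs hs0)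
  have h3 := h1.2
  linarith [theta_nonneg (d := d) β]

/-! ### Explicit lower bounds in dimension at least three and in dimension two. -/

theorem theta_ge_rpow_sub (hd : 3 ≤ d) {α β : ℝ} (hα : 0 < α) (hαβ : α ≤ β) :
    α ^ (2 - (d : ℝ)) / (d * ((d : ℝ) - 2) * unitBallVolume d) -
      (β ^ (2 - (d : ℝ)) / (d * ((d : ℝ) - 2) * unitBallVolume d) + β ^ 2 / d) ≤ theta d α := by
  have hv0 : 0 < unitBallVolume d := unitBallVolume_pos
  have hd3 : (3 : ℝ) ≤ d := by exact_mod_cast hd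
  have hd2 : (0 : ℝ) < d - 2 := by linarith
  have h := theta_sub_ge (d := d) (by omega) (Ψ := fun s =>
    s ^ (2 - (d : ℝ)) / (d * ((d : ℝ) - 2) * unitBallVolume d) + s ^ 2 / d) (fun s hs => by
      have h1 := (Real.hasDerivAt_rpow_const (p := 2 - (d : ℝ)) (Or.inl hs.ne')).div_const
        (d * ((d : ℝ) - 2) * unitBallVolume d)
      have h2 := (hasDerivAt_pow 2 s).div_const (d : ℝ)
      refine (h1.add h2).congr_deriv ?_
      rw [show (2 - (d : ℝ) - 1) = 1 - d by ring]
      have : (0 : ℝ) < d := by linarith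
      field_simp
      ring) hα hαβ
  have : 0 ≤ α ^ 2 / (d : ℝ) := by positivity
  linarith

theorem unitBallVolume_two : unitBallVolume 2 = Real.pi := by
  unfold unitBallVolume
  rw [measureReal_def, EuclideanSpace.volume_ball_fin_two]
  simp [Real.pi_nonneg]

theorem theta_two_ge_log_sub {α β : ℝ} (hα : 0 < α) (hαβ : α ≤ β) :
    Real.log α⁻¹ / (2 * Real.pi) - (β ^ 2 / 2 - Real.log β / (2 * Real.pi)) ≤ theta 2 α := by
  have hπ := Real.pi_pos
  have h := theta_sub_ge (d := 2) (by norm_num) (Ψ := fun s =>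
    s ^ 2 / 2 - Real.log s / (2 * Real.pi)) (fun s hs => by
      have h1 := (Real.hasDerivAt_log hs.ne').div_const (2 * Real.pi)
      have h2 := (hasDerivAt_pow 2 s).div_const (2 : ℝ)
      refine (h2.sub h1).congr_deriv ?_
      rw [unitBallVolume_two]
      norm_num [Real.rpow_neg_one]
      ring) hα hαβ
  rw [Real.log_inv, neg_div]
  have : 0 ≤ α ^ 2 / (2 : ℝ) := by positivity
  linarith

end OptimalCompliance

theorem proposition4p5 (d : ℕ) (hd : 1 ≤ d) :
    (∀ α : ℝ, 0 < α → OptimalCompliance.thetaExt d α < ⊤) ∧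
    0 < OptimalCompliance.t₁ d ∧
    (∀ᵐ α : ℝ, α ∈ Ioo 0 (OptimalCompliance.t₁ d) →
      DifferentiableAt ℝ (OptimalCompliance.theta d) α) ∧
    (∀ α ∈ Ioo 0 (OptimalCompliance.t₁ d), DifferentiableAt ℝ (OptimalCompliance.theta d) α →
      -deriv (OptimalCompliance.theta d) α ≥
        α ^ (1 - (d : ℝ)) / (d * OptimalCompliance.unitBallVolume d) - 2 * (α / d)) ∧
    (3 ≤ d → ∃ C : ℝ, ∀ α ∈ Ioo 0 (OptimalCompliance.t₁ d),
      OptimalCompliance.theta d α ≥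
        α ^ (2 - (d : ℝ)) / (d * ((d : ℝ) - 2) * OptimalCompliance.unitBallVolume d) - C) ∧
    (d = 2 → ∃ C : ℝ, ∀ α ∈ Ioo 0 (OptimalCompliance.t₁ d),
      OptimalCompliance.theta d α ≥ Real.log (α⁻¹) / (2 * Real.pi) - C) := by
  refine ⟨fun α hα => OptimalCompliance.thetaExt_lt_top hd hα, OptimalCompliance.t₁_pos hd, ?_,
    fun α hα hdiff => OptimalCompliance.neg_deriv_theta_ge hd hα.1 hdiff,
    -- The constant is the primitive evaluated at `β = t₁`, which does not depend on `α`.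
    fun h3 => ⟨_, fun α hα => OptimalCompliance.theta_ge_rpow_sub h3 hα.1 hα.2.le⟩, ?_⟩
  · filter_upwards [OptimalCompliance.ae_differentiableAt_theta hd] with α h hα
    exact h hα.1
  · rintro rfl
    exact ⟨_, fun α hα => OptimalCompliance.theta_two_ge_log_sub hα.1 hα.2.le⟩
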